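/- Let $\mathsf H_1\subseteq \mathsf H_0$ be complex Hilbert spaces with continuous embedding. Let $A$ be a self-adjoint operator in $\mathsf H_1$ that has a self-adjoint extension in $\mathsf H_0$, also denoted $A$, whose domain contains $\mathsf H_1$. Let $\Phi^A(t)=e^{-itA}$ be the strongly continuous unitary group on $\mathsf H_1$ generated by $-iA$, and let $E$ be the projection-valued spectral measure of the operator $A$ in $\mathsf H_0$. Let $B:\mathsf H_1\to\mathsf H_1$ be locally Lipschitz, and assume that there is a map $B'$ from $\mathsf H_1$ to the bounded (real-)linear operators on $\mathsf H_0$ such that for all $r,\varepsilon>0$ there are $C,\delta>0$ with $$\|B'(u)\|\le C,\qquad \|B(u+w)-B(u)-B'(u)w\|_{\mathsf H_0}\le \varepsilon\|w\|_{\mathsf H_0}$$ whenever $u,w\in \mathsf H_1$, $\|u\|_{\mathsf H_1}\le r$, $\|w\|_{\mathsf H_1}<\delta$. For $u_0\in\mathsf H_1$ let $\Phi(t)u_0=u(t)$, $0\le t<T^*(u_0)$, be the maximal solution in $C([0,T^*(u_0)),\mathsf H_1)$ of $$u(t)=\Phi^A(t)u_0-i\int_0^t\Phi^A(t-s)B(u(s))\,ds,$$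 and let $\Phi^B(t)$, $t\in\mathbb R$, be the (local) flow of $w_t=-iB(w)$ in $\mathsf H_1$. Let $a_1,\dots,a_m,b_1,\dots,b_m\in\mathbb R$ with $\sum_j a_j=\sum_j b_j=1$. For $h>0$ and $R>0$ put $P=E([-R,R])$ and $$\widetilde\Phi_{h}=\Phi^B(b_mh)\circ\Phi^A(a_mh)\circ P\circ\cdots\circ\Phi^B(b_1h)\circ\Phi^A(a_1h)\circ P .$$ **Theorem (Spectral approximation).** Let $u_0\in\mathsf H_1$ and $0<T<T^*(u_0)$, and write $h_n=T/n$, $\widetilde\Phi_n=\widetilde\Phi_{h_n}$. There exist $C>0$ and $n_0\in\mathbb N$, $n_0\geq 1$, such that for every $n\ge n_0$ and every $R>h_n^{-2}$ the iterates $\widetilde\Phi_n^k u_0$, $0\le k\le n$, are well defined in $\mathsf H_1$ (in particular $P$ maps the vectors to which it is applied into $\mathsf H_1$) and $$\max_{0\le k\le n}\big\|\Phi(kh_n)u_0-\widetilde\Phi_n^k u_0\big\|_{\mathsf H_0}\le C\,h_n .$$ -/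

import Mathlib

open scoped InnerProductSpace ENNReal

/-- A projection-valued measure on the Borel sets of `ℝ`, acting on a complex Hilbert space `H`. -/
structure ProjectionValuedMeasure (H : Type*) [NormedAddCommGroup H] [InnerProductSpace ℂ H]
    [CompleteSpace H] where
  /-- The projection attached to a set (meaningful for Borel sets only). -/
  proj : Set ℝ → H →L[ℂ] H
  isStarProjection : ∀ S, MeasurableSet S → IsStarProjection (proj S)
  univ_eq_one : proj Set.univ = 1
  inter_eq_mul : ∀ S S', MeasurableSet S → MeasurableSet S' →
    proj (S ∩ S') = proj S * proj S'
  hasSum_iUnion : ∀ f : ℕ → Set ℝ, (∀ i, MeasurableSet (f i)) →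
    Pairwise (Function.onFun Disjoint f) →
    ∀ x : H, HasSum (fun i => proj (f i) x) (proj (⋃ i, f i) x)

namespace ProjectionValuedMeasure

variable {H : Type*} [NormedAddCommGroup H] [InnerProductSpace ℂ H] [CompleteSpace H]

theorem inner_proj_self (E : ProjectionValuedMeasure H) {S : Set ℝ} (hS : MeasurableSet S)
    (x : H) : ⟪x, E.proj S x⟫_ℂ = ((‖E.proj S x‖ ^ 2 : ℝ) : ℂ) := by
  have h := E.isStarProjection S hS
  have h1 : E.proj S (E.proj S x) = E.proj S x :=
    congrArg (fun T : H →L[ℂ] H => T x) h.isIdempotentElem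
  have h2 : (E.proj S).adjoint = E.proj S := h.isSelfAdjoint
  calc ⟪x, E.proj S x⟫_ℂ = ⟪x, E.proj S (E.proj S x)⟫_ℂ := by rw [h1]
    _ = ⟪(E.proj S).adjoint x, E.proj S x⟫_ℂ :=
        (ContinuousLinearMap.adjoint_inner_left _ _ _).symm
    _ = ⟪E.proj S x, E.proj S x⟫_ℂ := by rw [h2]
    _ = _ := by rw [inner_self_eq_norm_sq_to_K]; norm_cast

theorem proj_empty (E : ProjectionValuedMeasure H) : E.proj ∅ = 0 := by
  ext x
  have h := E.hasSum_iUnion (fun _ => ∅) (fun _ => MeasurableSet.empty)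
    (fun _ _ _ => by simp [Function.onFun]) x
  have h0 := h.summable.tendsto_atTop_zero
  simpa using tendsto_nhds_unique tendsto_const_nhds h0

theorem hasSum_norm_sq (E : ProjectionValuedMeasure H) (x : H) (f : ℕ → Set ℝ)
    (hf : ∀ i, MeasurableSet (f i)) (hd : Pairwise (Function.onFun Disjoint f)) :
    HasSum (fun i => ‖E.proj (f i) x‖ ^ 2) (‖E.proj (⋃ i, f i) x‖ ^ 2) := by
  have h := (innerSL ℂ x).hasSum (E.hasSum_iUnion f hf hd x)
  simp only [innerSL_apply_apply] at h
  rw [E.inner_proj_self (MeasurableSet.iUnion hf)] at h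
  simp only [fun i => E.inner_proj_self (hf i) x] at h
  exact_mod_cast h

/-- The scalar spectral measure `S ↦ ⟪x, E(S) x⟫ = ‖E(S) x‖²` of the vector `x`. -/
noncomputable def scalarMeasure (E : ProjectionValuedMeasure H) (x : H) :
    MeasureTheory.Measure ℝ :=
  MeasureTheory.Measure.ofMeasurable (fun S _ => ENNReal.ofReal (‖E.proj S x‖ ^ 2))
    (by simp [E.proj_empty])
    (fun f hf hd => by
      have h := E.hasSum_norm_sq x f hf hd
      rw [← h.tsum_eq]
      exact ENNReal.ofReal_tsum_of_nonneg (fun i => sq_nonneg _) h.summable)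

end ProjectionValuedMeasure

/-- `E` is the projection-valued spectral measure of the operator `A`, that is
`A = ∫ λ dE(λ)`: the domain of `A` consists of the vectors `x` with `∫ λ² d⟪x, E(λ)x⟫ < ∞`,
and `⟪x, A x⟫ = ∫ λ d⟪x, E(λ)x⟫` on the domain. -/
structure IsSpectralMeasureOf {H : Type*} [NormedAddCommGroup H] [InnerProductSpace ℂ H]
    [CompleteSpace H] (A : H →ₗ.[ℂ] H) (E : ProjectionValuedMeasure H) : Prop where
  mem_domain_iff : ∀ x : H, x ∈ A.domain ↔
    MeasureTheory.Integrable (fun l : ℝ => l ^ 2) (E.scalarMeasure x)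
  inner_apply : ∀ x : A.domain,
    ⟪(x : H), A x⟫_ℂ = ((∫ l : ℝ, l ∂(E.scalarMeasure (x : H)) : ℝ) : ℂ)

/-- `U` is the strongly continuous one-parameter unitary group with generator `-iA`
(including the exact domain of the generator). -/
structure IsUnitaryGroupGeneratedBy {H : Type*} [NormedAddCommGroup H] [InnerProductSpace ℂ H]
    [CompleteSpace H] (A : H →ₗ.[ℂ] H) (U : ℝ → H →L[ℂ] H) : Prop where
  mem_unitary : ∀ t, U t ∈ unitary (H →L[ℂ] H)
  zero : U 0 = 1
  add : ∀ s t, U (s + t) = U s * U t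
  continuous : ∀ x, Continuous fun t => U t x
  hasDerivAt_iff : ∀ x y : H, HasDerivAt (fun t => U t x) y 0 ↔
    ∃ hx : x ∈ A.domain, y = -(Complex.I • A ⟨x, hx⟩)

section Flows

variable {H : Type*} [NormedAddCommGroup H] [InnerProductSpace ℂ H]

/-- `u ∈ C([0,T], H)` solves the Duhamel equation
`u(t) = Φᴬ(t) u₀ - i ∫₀ᵗ Φᴬ(t - s) B(u(s)) ds` on `[0,T]`. -/
def IsDuhamelSolution (ΦA : ℝ → H →L[ℂ] H) (B : H → H) (u₀ : H) (T : ℝ) (u : ℝ → H) : Prop :=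
  ContinuousOn u (Set.Icc 0 T) ∧
    ∀ t ∈ Set.Icc 0 T, u t = ΦA t u₀ - Complex.I • ∫ s in (0 : ℝ)..t, ΦA (t - s) (B (u s))

/-- The maximal existence time `T*(u₀) ∈ [0, ∞]` of the Duhamel equation. -/
noncomputable def maximalTime (ΦA : ℝ → H →L[ℂ] H) (B : H → H) (u₀ : H) : EReal :=
  sSup {τ : EReal | ∃ T : ℝ, 0 ≤ T ∧ τ = T ∧ ∃ u, IsDuhamelSolution ΦA B u₀ T u}

/-- The exact flow `Φ(t)`, `t ≥ 0`, of `u' = -i(A + B)u` as a partial map: `Φ(t)u₀` is the value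
at time `t` of the solution of the Duhamel equation, defined when a solution on `[0,t]` exists. -/
noncomputable def exactFlow (ΦA : ℝ → H →L[ℂ] H) (B : H → H) (t : ℝ) (u₀ : H) : Part H :=
  ⟨0 ≤ t ∧ ∃ u, IsDuhamelSolution ΦA B u₀ t u, fun h => h.2.choose t⟩

/-- The flow `Φᴮ(t)`, `t ∈ ℝ`, of `w' = -i B(w)` as a partial map: `Φᴮ(t)w₀` is the value at
time `t` of the solution starting at `w₀`, defined when a solution exists on the closed interval
between `0` and `t`. -/
noncomputable def nonlinearFlow (B : H → H) (t : ℝ) (w₀ : H) : Part H :=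
  ⟨∃ w : ℝ → H, w 0 = w₀ ∧
      IsIntegralCurveOn w (fun _ x => -(Complex.I • B x)) (Set.uIcc 0 t),
    fun h => h.choose t⟩

/-- One step of the splitting scheme with coefficients `a`, `b` and step size `h`,
`Φᴮ(b_m h) ∘ Ψ(a_m h) ∘ ⋯ ∘ Φᴮ(b_1 h) ∘ Ψ(a_1 h)`,
as a composition of partial maps; `a 0`, `b 0` stand for `a_1`, `b_1`. -/
noncomputable def splittingStep (ΨA ΦB : ℝ → H → Part H) {m : ℕ} (a b : Fin m → ℝ) (h : ℝ)
    (x : H) : Part H :=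
  (List.finRange m).foldl (fun y j => (y.bind (ΨA (a j * h))).bind (ΦB (b j * h))) (Part.some x)

/-- The `k`-th iterate of a partial map. -/
def partialIterate (F : H → Part H) : ℕ → H → Part H
  | 0, x => Part.some x
  | k + 1, x => (partialIterate F k x).bind F

end Flows

section Embedding

variable {H₁ H₀ : Type*} [NormedAddCommGroup H₁] [InnerProductSpace ℂ H₁]
  [NormedAddCommGroup H₀] [InnerProductSpace ℂ H₀]

/-- The operator `P` of `H₀` regarded as a partial map of the subspace `H₁` (embedded by `ι`):
it is defined at `x ∈ H₁` exactly when `P x` belongs to `H₁`. -/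
noncomputable def restrictToSubspace (ι : H₁ →L[ℂ] H₀) (P : H₀ →L[ℂ] H₀) (x : H₁) : Part H₁ :=
  ⟨∃ y : H₁, ι y = P (ι x), fun h => h.choose⟩

/-- The truncated linear flow `Φᴬ(t) ∘ P` on `H₁`. -/
noncomputable def truncatedFlow (ι : H₁ →L[ℂ] H₀) (P : H₀ →L[ℂ] H₀) (ΦA : ℝ → H₁ →L[ℂ] H₁)
    (t : ℝ) (x : H₁) : Part H₁ :=
  (restrictToSubspace ι P x).map (ΦA t)

end Embedding

/-! Write `V = -iB`, and `P` for `E([-R,R])`. By the closed graph theorem `A₀ ∘ ι` is bounded from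
`H₁` to `H₀`. Hence, for `x` in `H₁`, the differences `Φᴬ(t)x - x` and `Px - x` have `H₀`-norms at
most `C|t|‖x‖` and `(C/R)‖x‖`, with the `H₁`-norm of `x` on the right. In `H₁` itself both tend to
zero, uniformly on compact sets but without a rate.

The iterates are compared with `P u(kh)`, and inside a step with `Φᴬ(τ)P u(t) + β V(u(t))`, where
`τ` and `β` are `h` times the sums of the coefficients used so far. Since `P` is idempotent and
commutes with `Φᴬ`, a linear substep transports the first term exactly; the only consistency error
falls on the second term, which already carries a factor `h`. Truncation errors therefore do not
pile up. A substep turns an error `D` into at most `(1 + Gh)D + Gh(η + h)`, with `η` the consistency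
error (`norm_substep_le`), and `O(1/h)` substeps give `O(η + h)`.

This recursion runs in two norms at once (`exists_mem_partialIterate`). In `H₁` the number `η` is
small but fixed: the iterates stay in a tube around the trajectory, where `B` is Lipschitz and `Φᴮ`
is defined for short times. In `H₀` one may take `η = C₀h`, which gives the rate. The Lipschitz
bound of `B` in the norm of `H₀` comes from `B'` and holds only for increments small in `H₁`, so the
`H₀` estimate needs the `H₁` one.

It remains to see that `P` acts on `H₁` as a contraction (`exists_spectral_truncation`). The
embedding intertwines `(1 + A²)⁻¹` with `(1 + A₀²)⁻¹`, hence also continuous functions of them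
(`comp_cfc_eq`). Functions decreasing to the indicator of `[(1 + R²)⁻¹, ∞)` converge strongly in
both spaces, and in `H₀` the limit is `P` (`tendsto_cfc_cutoff`). -/

namespace LinearPMap

/-! ### The bounded operator `(1 + A²)⁻¹` of a self-adjoint operator. -/

section

variable {H : Type*} [NormedAddCommGroup H] [InnerProductSpace ℂ H]

/-- `S = (1 + A²)⁻¹`. -/
def IsInvOneAddSq (A : H →ₗ.[ℂ] H) (S : H →L[ℂ] H) : Prop :=
  ∀ y, ∃ z, (S y, z) ∈ A.graph ∧ (z, y - S y) ∈ A.graph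

end

variable {H : Type*} [NormedAddCommGroup H] [InnerProductSpace ℂ H] [CompleteSpace H]
  {A : H →ₗ.[ℂ] H}

theorem inner_eq_of_mem_graph (hA : IsSelfAdjoint A) {x y x' y' : H} (h : (x, y) ∈ A.graph)
    (h' : (x', y') ∈ A.graph) : ⟪y, x'⟫_ℂ = ⟪x, y'⟫_ℂ := by
  have hd := hA.dense_domain
  have hf := adjoint_isFormalAdjoint hd
  rw [isSelfAdjoint_def.1 hA] at hf
  rw [mem_graph_iff] at h h'
  obtain ⟨a, rfl, rfl⟩ := h
  obtain ⟨b, rfl, rfl⟩ := h'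
  exact hf a b

theorem mem_graph_of_forall_inner (hA : IsSelfAdjoint A) {z w : H}
    (h : ∀ x y, (x, y) ∈ A.graph → ⟪w, x⟫_ℂ = ⟪z, y⟫_ℂ) : (z, w) ∈ A.graph := by
  have hd := hA.dense_domain
  have h' : ∀ x : A.domain, ⟪w, (x : H)⟫_ℂ = ⟪z, A x⟫_ℂ := fun x => h _ _ (A.mem_graph x)
  have hz : z ∈ A.adjoint.domain := mem_adjoint_domain_of_exists z ⟨w, h'⟩
  have hw := adjoint_apply_eq hd ⟨z, hz⟩ h'
  have hm : (z, w) ∈ A.adjoint.graph := hw ▸ A.adjoint.mem_graph ⟨z, hz⟩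
  rwa [isSelfAdjoint_def.1 hA] at hm

/-- Von Neumann's argument: project `(y, 0)` orthogonally onto the closed graph of `A`, in the
Hilbert sum. If `(x, z)` is the projection, orthogonality of `(y - x, -z)` to the graph says that
`z` lies in the domain of the adjoint, which maps it to `y - x`. -/
theorem exists_isInvOneAddSq (hA : IsSelfAdjoint A) : ∃ S, IsInvOneAddSq A S := by
  let e := WithLp.prodContinuousLinearEquiv 2 ℂ H H
  let G : Submodule ℂ (WithLp 2 (H × H)) :=
    A.graph.comap (e.toLinearEquiv : WithLp 2 (H × H) →ₗ[ℂ] H × H)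
  have hGc : _root_.IsClosed (G : Set (WithLp 2 (H × H))) :=
    _root_.IsClosed.preimage e.continuous hA.isClosed
  have : CompleteSpace G := hGc.completeSpace_coe
  let inl : H →L[ℂ] WithLp 2 (H × H) :=
    (e.symm : (H × H) →L[ℂ] WithLp 2 (H × H)).comp (ContinuousLinearMap.inl ℂ H H)
  refine ⟨(ContinuousLinearMap.fst ℂ H H).comp
    ((e : WithLp 2 (H × H) →L[ℂ] H × H).comp (G.starProjection.comp inl)), fun y => ?_⟩
  set p := G.starProjection (inl y) with hp
  have hpG : p ∈ G := G.starProjection_apply_mem _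
  have horth := G.sub_starProjection_mem_orthogonal (inl y)
  refine ⟨(e p).2, hpG, mem_graph_of_forall_inner hA fun a b hab => ?_⟩
  have h := (Submodule.mem_orthogonal' _ _).1 horth (e.symm (a, b)) (by simpa [G] using hab)
  rw [← hp, WithLp.prod_inner_apply] at h
  have h' : ⟪y - (e p).1, a⟫_ℂ + ⟪0 - (e p).2, b⟫_ℂ = 0 := h
  rw [zero_sub, inner_neg_left] at h'
  change ⟪y - (e p).1, a⟫_ℂ = ⟪(e p).2, b⟫_ℂ
  linear_combination h'

namespace IsInvOneAddSq

variable {S : H →L[ℂ] H}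

/-- Two solutions differ by `d`, `e` with `A d = e` and `A e = -d`; symmetry gives `‖e‖² = -‖d‖²`.
-/
theorem eq_of_mem (hA : IsSelfAdjoint A) (hS : IsInvOneAddSq A S) {x y z : H}
    (h₁ : (x, z) ∈ A.graph) (h₂ : (z, y - x) ∈ A.graph) : S y = x := by
  obtain ⟨w, h₃, h₄⟩ := hS y
  have h₅ := A.graph.sub_mem h₃ h₁
  have h₆ := A.graph.sub_mem h₄ h₂
  have h := inner_eq_of_mem_graph hA h₅ h₆
  have h₇ : y - S y - (y - x) = -(S y - x) := by abel
  simp only [h₇, inner_neg_right] at h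
  simp only [inner_self_eq_norm_sq_to_K] at h
  have h' : ‖w - z‖ ^ 2 = - ‖S y - x‖ ^ 2 := by exact_mod_cast h
  have : ‖S y - x‖ ^ 2 = 0 := by nlinarith [sq_nonneg ‖w - z‖, sq_nonneg ‖S y - x‖]
  simpa [sub_eq_zero] using this

theorem isSelfAdjoint (hA : IsSelfAdjoint A) (hS : IsInvOneAddSq A S) : IsSelfAdjoint S := by
  rw [ContinuousLinearMap.isSelfAdjoint_iff_isSymmetric]
  intro y y'
  obtain ⟨z, h₁, h₂⟩ := hS y
  obtain ⟨z', h₁', h₂'⟩ := hS y'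
  have h := inner_eq_of_mem_graph hA h₁ h₂'
  have h' := inner_eq_of_mem_graph hA h₂ h₁'
  rw [inner_sub_right] at h
  rw [inner_sub_left] at h'
  change ⟪S y, y'⟫_ℂ = ⟪y, S y'⟫_ℂ
  linear_combination -h - h'

/-- The quadratic form of `(1 + A²)⁻¹`. -/
theorem inner_self (hA : IsSelfAdjoint A) {y z x : H}
    (h₁ : (x, z) ∈ A.graph) (h₂ : (z, y - x) ∈ A.graph) :
    RCLike.re ⟪x, y⟫_ℂ = ‖x‖ ^ 2 + ‖z‖ ^ 2 := by
  have h := inner_eq_of_mem_graph hA h₁ h₂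
  rw [inner_sub_right, inner_self_eq_norm_sq_to_K, inner_self_eq_norm_sq_to_K] at h
  have h' : ⟪x, y⟫_ℂ = ((‖x‖ ^ 2 + ‖z‖ ^ 2 : ℝ) : ℂ) := by
    push_cast
    linear_combination -h
  rw [h']
  simp only [RCLike.re_to_complex, Complex.ofReal_re]

theorem nonneg (hA : IsSelfAdjoint A) (hS : IsInvOneAddSq A S) : 0 ≤ S := by
  rw [ContinuousLinearMap.nonneg_iff_isPositive, ContinuousLinearMap.isPositive_def']
  refine ⟨hS.isSelfAdjoint hA, fun y => ?_⟩
  obtain ⟨z, h₁, h₂⟩ := hS y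
  have := inner_self hA h₁ h₂
  rw [ContinuousLinearMap.reApplyInnerSelf_apply, this]
  positivity

/-- By self-adjointness the orthogonal complement of the range is the kernel, which is trivial.
Density is what later extends the convergence of the truncations from the range of `S` to the whole
space. -/
theorem denseRange (hA : IsSelfAdjoint A) (hS : IsInvOneAddSq A S) : DenseRange S := by
  have h : (LinearMap.range (S : H →ₗ[ℂ] H)).topologicalClosure = ⊤ := by
    rw [Submodule.topologicalClosure_eq_top_iff, Submodule.eq_bot_iff]
    intro y hy
    have h0 : S y = 0 := by
      refine ext_inner_right ℂ fun v => ?_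
      have := (Submodule.mem_orthogonal' _ _).1 hy (S v) ⟨v, rfl⟩
      have hs := (ContinuousLinearMap.isSelfAdjoint_iff_isSymmetric.1 (hS.isSelfAdjoint hA)) y v
      simp only [inner_zero_left]
      exact hs.trans this
    obtain ⟨z, h₁, h₂⟩ := hS y
    rw [h0] at h₁ h₂
    have hz : z = 0 := A.mem_graph_snd_inj h₁ A.graph.zero_mem rfl
    rw [hz] at h₂
    simpa using A.mem_graph_snd_inj h₂ A.graph.zero_mem rfl
  exact Submodule.dense_iff_topologicalClosure_eq_top.2 h

end IsInvOneAddSq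

/-- `(1 + A²)⁻¹` commutes with every operator intertwining the operators `A` and `A'`. -/
theorem IsInvOneAddSq.comp_eq {H K : Type*} [NormedAddCommGroup H] [InnerProductSpace ℂ H]
    [NormedAddCommGroup K] [InnerProductSpace ℂ K] [CompleteSpace K]
    {A : H →ₗ.[ℂ] H} {S : H →L[ℂ] H}
    {A' : K →ₗ.[ℂ] K} {S' : K →L[ℂ] K} (hA' : IsSelfAdjoint A')
    (hS : IsInvOneAddSq A S) (hS' : IsInvOneAddSq A' S') (J : H →L[ℂ] K)
    (hJ : ∀ x y, (x, y) ∈ A.graph → (J x, J y) ∈ A'.graph) : J.comp S = S'.comp J := by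
  ext y
  obtain ⟨z, h₁, h₂⟩ := hS y
  have h₃ := hJ _ _ h₂
  rw [J.map_sub] at h₃
  exact (hS'.eq_of_mem hA' (hJ _ _ h₁) h₃).symm

end LinearPMap

/-! ### Intertwining operators and the continuous functional calculus. -/

namespace ContinuousLinearMap

variable {H K : Type*} [NormedAddCommGroup H] [InnerProductSpace ℂ H]
  [NormedAddCommGroup K] [InnerProductSpace ℂ K]

open Polynomial in
theorem comp_aeval_eq {X : H →L[ℂ] H} {Y : K →L[ℂ] K} {J : H →L[ℂ] K}
    (h : J.comp X = Y.comp J) (p : ℝ[X]) : J.comp (aeval X p) = (aeval Y p).comp J := by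
  induction p using Polynomial.induction_on' with
  | add p q hp hq => simp only [map_add, comp_add, add_comp, hp, hq]
  | monomial n r =>
    simp only [aeval_monomial]
    have hn : J.comp (X ^ n) = (Y ^ n).comp J := by
      induction n with
      | zero => rfl
      | succ n ih =>
        rw [pow_succ, pow_succ]
        change (J.comp (X ^ n)).comp X = (Y ^ n).comp (Y.comp J)
        rw [ih, ← h]; rfl
    rw [← Algebra.smul_def, ← Algebra.smul_def]
    ext x
    have h' := congrArg (fun T => T x) hn
    simp only [coe_comp, Function.comp_apply] at h'
    rw [coe_comp, Function.comp_apply, smul_apply, coe_comp, Function.comp_apply, smul_apply,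
      ← h', ← Complex.coe_smul, map_smul, Complex.coe_smul]

/-- Intertwining passes to polynomials algebraically, and to continuous functions by Weierstrass
approximation on an interval containing both spectra. -/
theorem comp_cfc_eq [CompleteSpace H] [CompleteSpace K] {X : H →L[ℂ] H} {Y : K →L[ℂ] K} {J : H →L[ℂ] K}
    (hX : IsSelfAdjoint X) (hY : IsSelfAdjoint Y)
    (h : J.comp X = Y.comp J) {f : ℝ → ℝ} (hf : Continuous f) :
    J.comp (cfc f X) = (cfc f Y).comp J := by
  refine eq_of_forall_dist_le fun ε hε => ?_
  obtain ⟨M, hM⟩ : ∃ M, spectrum ℝ X ∪ spectrum ℝ Y ⊆ Set.Icc (-M) M := by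
    have hb : Bornology.IsBounded (spectrum ℝ X ∪ spectrum ℝ Y) :=
      (ContinuousFunctionalCalculus.isCompact_spectrum (R := ℝ) X).isBounded.union
        (ContinuousFunctionalCalculus.isCompact_spectrum (R := ℝ) Y).isBounded
    obtain ⟨M, hM⟩ := hb.exists_norm_le
    exact ⟨M, fun x hx => abs_le.1 (hM x hx)⟩
  have hδ : 0 < ε / (2 * (‖J‖ + 1)) := by positivity
  obtain ⟨p, hp⟩ := exists_polynomial_near_of_continuousOn (-M) M f hf.continuousOn _ hδ
  have h1 : ‖cfc f X - Polynomial.aeval X p‖ ≤ ε / (2 * (‖J‖ + 1)) := by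
    rw [← cfc_polynomial (R := ℝ) p X, ← cfc_sub f p.eval X hf.continuousOn]
    refine norm_cfc_le hδ.le fun x hx => ?_
    rw [norm_sub_rev]
    exact (hp x (hM (Or.inl hx))).le
  have h2 : ‖cfc f Y - Polynomial.aeval Y p‖ ≤ ε / (2 * (‖J‖ + 1)) := by
    rw [← cfc_polynomial (R := ℝ) p Y, ← cfc_sub f p.eval Y hf.continuousOn]
    refine norm_cfc_le hδ.le fun x hx => ?_
    rw [norm_sub_rev]
    exact (hp x (hM (Or.inr hx))).le
  have h3 : J.comp (cfc f X) - (cfc f Y).comp J =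
      J.comp (cfc f X - Polynomial.aeval X p) - (cfc f Y - Polynomial.aeval Y p).comp J := by
    rw [comp_sub, sub_comp, comp_aeval_eq h]; abel
  rw [dist_eq_norm, h3]
  calc _ ≤ ‖J‖ * (ε / (2 * (‖J‖ + 1))) + (ε / (2 * (‖J‖ + 1))) * ‖J‖ :=
        (norm_sub_le _ _).trans (add_le_add ((opNorm_comp_le _ _).trans (by gcongr))
          ((opNorm_comp_le _ _).trans (by gcongr)))
    _ = ε * (‖J‖ / (‖J‖ + 1)) := by field_simp; ring
    _ ≤ ε * 1 := by
        gcongr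
        exact (div_le_one (by positivity)).2 (by linarith [norm_nonneg J])
    _ = ε := mul_one _

end ContinuousLinearMap

/-! ### Continuous cutoffs of a self-adjoint operator. -/

open Filter Topology

/-- A continuous approximation from above of the indicator function of `[c, ∞)`. -/
noncomputable def cutoff (c : ℝ) (n : ℕ) (t : ℝ) : ℝ := max 0 (min 1 (1 + (n + 1) * (t - c)))

theorem continuous_cutoff (c : ℝ) (n : ℕ) : Continuous (cutoff c n) := by
  unfold cutoff; fun_prop

theorem cutoff_nonneg (c : ℝ) (n : ℕ) (t : ℝ) : 0 ≤ cutoff c n t := le_max_left _ _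

theorem cutoff_le_one (c : ℝ) (n : ℕ) (t : ℝ) : cutoff c n t ≤ 1 :=
  max_le zero_le_one (min_le_left _ _)

theorem cutoff_eq_one {c t : ℝ} (n : ℕ) (h : c ≤ t) : cutoff c n t = 1 := by
  have : 0 ≤ ((n : ℝ) + 1) * (t - c) := mul_nonneg (by positivity) (by linarith)
  rw [cutoff, min_eq_left (by linarith), max_eq_right zero_le_one]

theorem cutoff_eq_zero {c t : ℝ} (n : ℕ) (h : 1 ≤ ((n : ℝ) + 1) * (c - t)) :
    cutoff c n t = 0 := by
  rw [cutoff, max_eq_left]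
  exact (min_le_right _ _).trans (by nlinarith)

theorem cutoff_antitone (c t : ℝ) : Antitone fun n => cutoff c n t := by
  intro n m h
  have h' : (n : ℝ) ≤ m := by exact_mod_cast h
  rcases le_total c t with hc | hc
  · simp only [cutoff_eq_one _ hc, le_refl]
  · simp only [cutoff]
    gcongr max 0 (min 1 (1 + ?_))
    nlinarith

namespace ContinuousLinearMap

variable {H : Type*} [NormedAddCommGroup H] [InnerProductSpace ℂ H] [CompleteSpace H]

theorem nonneg_iff_re_inner {T : H →L[ℂ] H} :
    0 ≤ T ↔ IsSelfAdjoint T ∧ ∀ x, 0 ≤ RCLike.re ⟪T x, x⟫_ℂ := by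
  rw [nonneg_iff_isPositive, isPositive_def']; rfl

theorem le_iff_re_inner {S T : H →L[ℂ] H} (hS : IsSelfAdjoint S) (hT : IsSelfAdjoint T) :
    S ≤ T ↔ ∀ x, RCLike.re ⟪S x, x⟫_ℂ ≤ RCLike.re ⟪T x, x⟫_ℂ := by
  rw [← sub_nonneg, nonneg_iff_re_inner]
  simp [hT.sub hS]

theorem norm_cfc_cutoff_apply_le (S : H →L[ℂ] H) (c : ℝ) (n : ℕ) (x : H) :
    ‖cfc (cutoff c n) S x‖ ≤ ‖x‖ := by
  have h : ‖cfc (cutoff c n) S‖ ≤ 1 := norm_cfc_le zero_le_one fun t _ => by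
    rw [Real.norm_of_nonneg (cutoff_nonneg c n t)]; exact cutoff_le_one c n t
  simpa using (cfc (cutoff c n) S).le_of_opNorm_le h x

/-- A decreasing sequence of functions of a self-adjoint operator converges strongly. -/
theorem exists_tendsto_cfc_cutoff (S : H →L[ℂ] H) (c : ℝ) (x : H) :
    ∃ y, Tendsto (fun n => cfc (cutoff c n) S x) atTop (𝓝 y) := by
  set Q : ℕ → H →L[ℂ] H := fun n => cfc (cutoff c n) S with hQ
  have hc : ∀ n, ContinuousOn (cutoff c n) (spectrum ℝ S) := fun n =>
    (continuous_cutoff c n).continuousOn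
  -- The difference of two cutoffs is `D = f(S)` with `0 ≤ f ≤ 1`, so `D² ≤ D` and `‖Dx‖² ≤ ⟪Dx,
  -- x⟫`. The quadratic forms decrease and are bounded below, so the vectors form a Cauchy sequence.
  have key : ∀ n m, n ≤ m →
      ‖Q m x - Q n x‖ ^ 2 ≤ RCLike.re ⟪Q n x, x⟫_ℂ - RCLike.re ⟪Q m x, x⟫_ℂ := by
    intro n m h
    set f : ℝ → ℝ := fun t => cutoff c n t - cutoff c m t with hf
    have hfc : ContinuousOn f (spectrum ℝ S) := (hc n).sub (hc m)
    have hD : Q n - Q m = cfc f S := (cfc_sub _ _ S (hc n) (hc m)).symm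
    have hsa : IsSelfAdjoint (cfc f S) := cfc_predicate f S
    have hsq : cfc f S * cfc f S ≤ cfc f S := by
      rw [← cfc_mul f f S hfc hfc]
      refine cfc_mono (fun t _ => ?_) (hfc.mul hfc) hfc
      have h0 : 0 ≤ f t := sub_nonneg.2 (cutoff_antitone c t h)
      have h1 : f t ≤ 1 := by
        have := cutoff_le_one c n t
        have := cutoff_nonneg c m t
        simp only [hf]; linarith
      nlinarith
    have h2 := (le_iff_re_inner (by rw [IsSelfAdjoint, star_mul, hsa]) hsa).1 hsq x
    have h3 : RCLike.re ⟪(cfc f S * cfc f S) x, x⟫_ℂ = ‖cfc f S x‖ ^ 2 := by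
      rw [show ⟪(cfc f S * cfc f S) x, x⟫_ℂ = ⟪cfc f S x, cfc f S x⟫_ℂ from
        (isSelfAdjoint_iff_isSymmetric.1 hsa) (cfc f S x) x]
      exact inner_self_eq_norm_sq _
    rw [h3, ← hD] at h2
    simpa [inner_sub_left, norm_sub_rev (Q m x)] using h2
  have hanti : Antitone fun n => RCLike.re ⟪Q n x, x⟫_ℂ := fun n m h => by
    have := key n m h
    simp only
    nlinarith [sq_nonneg ‖Q m x - Q n x‖]
  have hbdd : BddBelow (Set.range fun n => RCLike.re ⟪Q n x, x⟫_ℂ) := by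
    refine ⟨0, ?_⟩
    rintro _ ⟨n, rfl⟩
    exact (nonneg_iff_re_inner.1 (cfc_nonneg fun t _ => cutoff_nonneg c n t)).2 x
  have hlim := tendsto_atTop_ciInf hanti hbdd
  set l := ⨅ n, RCLike.re ⟪Q n x, x⟫_ℂ
  refine cauchySeq_tendsto_of_complete (Metric.cauchySeq_iff'.2 fun ε hε => ?_)
  obtain ⟨N, hN⟩ := (hlim.eventually (gt_mem_nhds (show l < l + ε ^ 2 by
    nlinarith [sq_pos_of_pos hε]))).exists
  refine ⟨N, fun n hn => ?_⟩
  rw [dist_eq_norm]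
  have h1 := key N n hn
  have h2 : l ≤ RCLike.re ⟪Q n x, x⟫_ℂ := ciInf_le hbdd n
  exact lt_of_pow_lt_pow_left₀ 2 hε.le (by linarith)

/-- On the spectrum, which lies in `[0, ∞)`, the factor `1 - cutoff c n t` vanishes for `t ≥ c`, so
`t` times it never exceeds `c`. -/
theorem norm_sub_cfc_cutoff_le {S : H →L[ℂ] H} (hS : 0 ≤ S) {c : ℝ} (hc : 0 ≤ c) (n : ℕ) (x : H) :
    ‖S x - cfc (cutoff c n) S (S x)‖ ≤ c * ‖x‖ := by
  have hsa : IsSelfAdjoint S := (nonneg_iff_re_inner.1 hS).1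
  have hcont := (continuous_cutoff c n).continuousOn (s := spectrum ℝ S)
  have h : S - cfc (cutoff c n) S * S = cfc (fun t => t - cutoff c n t * t) S := by
    rw [cfc_sub (fun t => t) (fun t => cutoff c n t * t) S continuousOn_id
      (hcont.mul continuousOn_id), cfc_mul (cutoff c n) (fun t => t) S hcont continuousOn_id,
      cfc_id' ℝ S]
  have h' : ‖S - cfc (cutoff c n) S * S‖ ≤ c := by
    rw [h]
    refine norm_cfc_le hc fun t ht => ?_
    have ht0 : 0 ≤ t := spectrum_nonneg_of_nonneg hS ht
    have h0 := cutoff_nonneg c n t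
    have h1 := cutoff_le_one c n t
    rcases le_total c t with hct | hct
    · rw [cutoff_eq_one n hct]; simpa using hc
    · rw [Real.norm_of_nonneg (by nlinarith)]; nlinarith
  exact (S - cfc (cutoff c n) S * S).le_of_opNorm_le h' x

theorem re_inner_algebraMap {H : Type*} [NormedAddCommGroup H] [InnerProductSpace ℂ H] (c : ℝ) (x : H) :
    RCLike.re ⟪algebraMap ℝ (H →L[ℂ] H) c x, x⟫_ℂ = c * ‖x‖ ^ 2 := by
  have h3 : RCLike.re ⟪x, x⟫_ℂ = ‖x‖ ^ 2 := inner_self_eq_norm_sq _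
  have h4 : algebraMap ℝ (H →L[ℂ] H) c x = (c : ℂ) • x := by
    simp [Algebra.algebraMap_eq_smul_one]
  rw [h4, inner_smul_left]
  simp only [Complex.conj_ofReal, RCLike.re_to_complex, Complex.re_ofReal_mul] at h3 ⊢
  rw [h3]

section Projection

variable {S P : H →L[ℂ] H} {c k : ℝ}

/-- The operator `S P + c(1 - P)` agrees with `S` on the range of `P` and is the constant `c` on the
complement. A form bound for `S` on the range of `P` thus becomes a bound for the whole spectrum of
this operator. -/
theorem isSelfAdjoint_mul_add (hS : IsSelfAdjoint S) (hP : IsStarProjection P)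
    (hSP : Commute S P) : IsSelfAdjoint (S * P + c • (1 - P)) := by
  refine IsSelfAdjoint.add ?_ (IsSelfAdjoint.smul (IsSelfAdjoint.all c)
    ((IsSelfAdjoint.one _).sub hP.isSelfAdjoint))
  rw [IsSelfAdjoint, star_mul, hP.isSelfAdjoint, hS, hSP]

theorem re_inner_mul_add (hP : IsStarProjection P) (hSP : Commute S P) (x : H) :
    RCLike.re ⟪(S * P + c • (1 - P)) x, x⟫_ℂ =
      RCLike.re ⟪S (P x), P x⟫_ℂ - c * ‖P x‖ ^ 2 + c * ‖x‖ ^ 2 := by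
  have hsym := isSelfAdjoint_iff_isSymmetric.1 hP.isSelfAdjoint
  have hPP : P (P x) = P x := congrArg (fun T => T x) hP.isIdempotentElem
  have h1 : ⟪S (P x), x⟫_ℂ = ⟪S (P x), P x⟫_ℂ := by
    have : S (P x) = P (S (P x)) := by
      conv_lhs => rw [← hPP]
      exact congrArg (fun T => T (P x)) hSP
    conv_lhs => rw [this]
    exact hsym _ _
  have h2 : RCLike.re ⟪P x, x⟫_ℂ = ‖P x‖ ^ 2 := by
    rw [← hPP, show ⟪P (P x), x⟫_ℂ = ⟪P x, P x⟫_ℂ from hsym _ _, hPP]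
    exact inner_self_eq_norm_sq _
  have h3 : RCLike.re ⟪x, x⟫_ℂ = ‖x‖ ^ 2 := inner_self_eq_norm_sq _
  have h4 : (S * P + c • (1 - P)) x = S (P x) + (c : ℂ) • (x - P x) := by simp
  rw [h4, inner_add_left, inner_smul_left, inner_sub_left, h1]
  simp only [Complex.conj_ofReal, map_add, RCLike.re_to_complex, Complex.re_ofReal_mul,
    Complex.sub_re] at h2 h3 ⊢
  rw [h2, h3]; ring

/-- With `W = S P + c(1 - P)` one has `P W = S P`, hence `P f(W) = f(S) P`; on the spectrum of `W`
the function is the constant `k`. -/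
theorem cfc_apply_of_range (hS : IsSelfAdjoint S) (hP : IsStarProjection P)
    (hSP : Commute S P) {f : ℝ → ℝ} (hf : Continuous f)
    (hk : ∀ t ∈ spectrum ℝ (S * P + c • (1 - P)), f t = k) {x : H} (hx : P x = x) :
    cfc f S x = k • x := by
  set W := S * P + c • (1 - P) with hW
  have hWs : IsSelfAdjoint W := isSelfAdjoint_mul_add hS hP hSP
  have hPP : P * P = P := hP.isIdempotentElem
  have h1 : P.comp W = S.comp P := by
    change P * W = S * P
    rw [hW, mul_add, ← mul_assoc, ← hSP.eq, mul_assoc, hPP, mul_smul_comm, mul_sub, hPP,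
      mul_one, sub_self, smul_zero, add_zero]
  have h2 := comp_cfc_eq hWs hS h1 hf
  have h3 : cfc f W = algebraMap ℝ _ k := by
    rw [cfc_congr (g := fun _ => k) hk, cfc_const k W]
  have h4 := congrArg (fun T => T x) h2
  simp only [coe_comp, Function.comp_apply, hx, h3] at h4
  rw [← h4, Algebra.algebraMap_eq_smul_one, smul_apply,
    show (1 : H →L[ℂ] H) x = x from rfl, ← Complex.coe_smul, map_smul, hx]

theorem cfc_cutoff_apply_of_le (hS : IsSelfAdjoint S) (hP : IsStarProjection P)
    (hSP : Commute S P) (h : ∀ x, P x = x → c * ‖x‖ ^ 2 ≤ RCLike.re ⟪S x, x⟫_ℂ) (n : ℕ)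
    {x : H} (hx : P x = x) : cfc (cutoff c n) S x = x := by
  have hW := isSelfAdjoint_mul_add (c := c) hS hP hSP
  have : algebraMap ℝ (H →L[ℂ] H) c ≤ S * P + c • (1 - P) := by
    rw [le_iff_re_inner (IsSelfAdjoint.algebraMap _ (IsSelfAdjoint.all c)) hW]
    intro x
    rw [re_inner_mul_add hP hSP]
    have := h (P x) (congrArg (fun T => T x) hP.isIdempotentElem)
    rw [re_inner_algebraMap]
    linarith
  rw [algebraMap_le_iff_le_spectrum] at this
  simpa using cfc_apply_of_range (k := 1) hS hP hSP (continuous_cutoff c n)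
    (fun t ht => cutoff_eq_one n (this t ht)) hx

theorem cfc_cutoff_apply_of_ge {c' : ℝ} (hS : IsSelfAdjoint S) (hP : IsStarProjection P)
    (hSP : Commute S P) (h : ∀ x, P x = x → RCLike.re ⟪S x, x⟫_ℂ ≤ c' * ‖x‖ ^ 2) {n : ℕ}
    (hn : 1 ≤ ((n : ℝ) + 1) * (c - c'))
    {x : H} (hx : P x = x) : cfc (cutoff c n) S x = 0 := by
  have hW := isSelfAdjoint_mul_add (c := c') hS hP hSP
  have : S * P + c' • (1 - P) ≤ algebraMap ℝ (H →L[ℂ] H) c' := by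
    rw [le_iff_re_inner hW (IsSelfAdjoint.algebraMap _ (IsSelfAdjoint.all c'))]
    intro x
    rw [re_inner_mul_add hP hSP]
    have := h (P x) (congrArg (fun T => T x) hP.isIdempotentElem)
    rw [re_inner_algebraMap]
    linarith
  rw [le_algebraMap_iff_spectrum_le] at this
  simpa using cfc_apply_of_range (k := 0) (c := c') hS hP hSP (continuous_cutoff c n)
    (fun t ht => cutoff_eq_zero n (hn.trans (by
      gcongr
      exact this t ht))) hx

end Projection

end ContinuousLinearMap

/-! ### Projection-valued measures and spectral projections of `A`. -/

open MeasureTheory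

namespace ProjectionValuedMeasure

variable {H : Type*} [NormedAddCommGroup H] [InnerProductSpace ℂ H] [CompleteSpace H]
  (E : ProjectionValuedMeasure H)

theorem scalarMeasure_apply (x : H) {S : Set ℝ} (hS : MeasurableSet S) :
    E.scalarMeasure x S = ENNReal.ofReal (‖E.proj S x‖ ^ 2) :=
  Measure.ofMeasurable_apply S hS

theorem norm_proj_apply_le {S : Set ℝ} (hS : MeasurableSet S) (x : H) : ‖E.proj S x‖ ≤ ‖x‖ := by
  have h := E.inner_proj_self hS x
  have h1 : ‖E.proj S x‖ ^ 2 ≤ ‖x‖ * ‖E.proj S x‖ := by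
    calc ‖E.proj S x‖ ^ 2 = ‖((‖E.proj S x‖ ^ 2 : ℝ) : ℂ)‖ := by simp
      _ ≤ _ := by rw [← h]; exact norm_inner_le_norm _ _
  by_contra! hlt
  nlinarith [norm_nonneg x]

instance isFiniteMeasure_scalarMeasure (x : H) : IsFiniteMeasure (E.scalarMeasure x) :=
  ⟨by rw [E.scalarMeasure_apply x MeasurableSet.univ]; exact ENNReal.ofReal_lt_top⟩

theorem proj_proj {S T : Set ℝ} (hS : MeasurableSet S) (hT : MeasurableSet T) (x : H) :
    E.proj S (E.proj T x) = E.proj (S ∩ T) x := by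
  rw [E.inter_eq_mul S T hS hT]; rfl

theorem proj_add_proj_of_disjoint {S T : Set ℝ} (hS : MeasurableSet S) (hT : MeasurableSet T)
    (h : Disjoint S T) (x : H) : E.proj (S ∪ T) x = E.proj S x + E.proj T x := by
  let f : ℕ → Set ℝ := fun n => if n = 0 then S else if n = 1 then T else ∅
  have hf : ∀ i, MeasurableSet (f i) := fun i => by
    simp only [f]; split_ifs <;> simp [hS, hT]
  have hd : Pairwise (Function.onFun Disjoint f) := by
    intro i j hij
    simp only [Function.onFun, f]
    split_ifs <;> simp_all [h.symm]
  have hu : ⋃ i, f i = S ∪ T := by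
    ext t
    simp only [Set.mem_iUnion, Set.mem_union, f]
    constructor
    · rintro ⟨i, hi⟩
      split_ifs at hi <;> simp_all
    · rintro (hi | hi)
      · exact ⟨0, by simpa using hi⟩
      · exact ⟨1, by simpa using hi⟩
  have h1 := E.hasSum_iUnion f hf hd x
  rw [hu] at h1
  have h2 : HasSum (fun i => E.proj (f i) x) (∑ i ∈ Finset.range 2, E.proj (f i) x) :=
    hasSum_sum_of_ne_finset_zero fun i hi => by
      have : 1 < i := by simpa using hi
      simp only [f]
      rw [if_neg (by omega), if_neg (by omega), E.proj_empty]; rfl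
  rw [h1.unique h2]
  simp [Finset.sum_range_succ, f]

theorem proj_compl {S : Set ℝ} (hS : MeasurableSet S) (x : H) :
    E.proj Sᶜ x = x - E.proj S x := by
  have h := E.proj_add_proj_of_disjoint hS hS.compl disjoint_compl_right x
  rw [Set.union_compl_self, E.univ_eq_one] at h
  rw [eq_sub_iff_add_eq', ← h]; rfl

theorem inner_proj_left {S : Set ℝ} (hS : MeasurableSet S) (x y : H) :
    ⟪E.proj S x, y⟫_ℂ = ⟪x, E.proj S y⟫_ℂ :=
  (ContinuousLinearMap.isSelfAdjoint_iff_isSymmetric.1 (E.isStarProjection S hS).isSelfAdjoint) x y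

theorem inner_proj_proj_of_disjoint {S T : Set ℝ} (hS : MeasurableSet S) (hT : MeasurableSet T)
    (h : Disjoint S T) (x y : H) : ⟪E.proj S x, E.proj T y⟫_ℂ = 0 := by
  rw [E.inner_proj_left hS, E.proj_proj hS hT, h.inter_eq, E.proj_empty]; simp

theorem norm_sq_eq_add_compl {S : Set ℝ} (hS : MeasurableSet S) (x : H) :
    ‖x‖ ^ 2 = ‖E.proj S x‖ ^ 2 + ‖E.proj Sᶜ x‖ ^ 2 := by
  have h := E.inner_proj_proj_of_disjoint hS hS.compl disjoint_compl_right x x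
  have h2 := norm_add_sq_eq_norm_sq_add_norm_sq_of_inner_eq_zero _ _ h
  rw [E.proj_compl hS] at h2 ⊢
  rw [add_sub_cancel] at h2
  simpa [sq] using h2

/-- Continuity from below of a projection-valued measure. -/
theorem tendsto_proj_of_monotone {S : ℕ → Set ℝ} (hS : ∀ n, MeasurableSet (S n))
    (hmono : Monotone S) (x : H) :
    Tendsto (fun n => E.proj (S n) x) atTop (𝓝 (E.proj (⋃ n, S n) x)) := by
  have hU := MeasurableSet.iUnion hS
  have h1 := tendsto_measure_iUnion_atTop (μ := E.scalarMeasure x) hmono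
  rw [E.scalarMeasure_apply x hU] at h1
  have h2 := (ENNReal.tendsto_toReal ENNReal.ofReal_ne_top).comp h1
  rw [ENNReal.toReal_ofReal (by positivity)] at h2
  have h3 : ∀ n, ‖E.proj (S n) x - E.proj (⋃ n, S n) x‖ ^ 2 =
      ‖E.proj (⋃ n, S n) x‖ ^ 2 - (E.scalarMeasure x (S n)).toReal := by
    intro n
    rw [E.scalarMeasure_apply x (hS n), ENNReal.toReal_ofReal (by positivity),
      E.norm_sq_eq_add_compl (hS n) (E.proj (⋃ n, S n) x), E.proj_compl (hS n),
      E.proj_proj (hS n) hU, Set.inter_eq_left.2 (Set.subset_iUnion S n), norm_sub_rev]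
    ring
  have h4 : Tendsto (fun n => ‖E.proj (S n) x - E.proj (⋃ n, S n) x‖ ^ 2) atTop (𝓝 0) := by
    simp only [h3]
    have h5 := h2.const_sub (‖E.proj (⋃ n, S n) x‖ ^ 2)
    rwa [sub_self] at h5
  rw [tendsto_iff_norm_sub_tendsto_zero]
  simpa using h4.sqrt

theorem scalarMeasure_proj {S : Set ℝ} (hS : MeasurableSet S) (x : H) :
    E.scalarMeasure (E.proj S x) = (E.scalarMeasure x).restrict S := by
  ext T hT
  rw [Measure.restrict_apply hT, E.scalarMeasure_apply _ hT,
    E.scalarMeasure_apply _ (hT.inter hS), E.proj_proj hT hS]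

/-- The scalar measure of a sum of vectors from the ranges of complementary projections does not
depend on relative phases. -/
theorem scalarMeasure_add_smul {S : Set ℝ} (hS : MeasurableSet S) (x y : H) {ω : ℂ}
    (hω : ‖ω‖ = 1) : E.scalarMeasure (E.proj S x + ω • E.proj Sᶜ y) =
      E.scalarMeasure (E.proj S x) + E.scalarMeasure (E.proj Sᶜ y) := by
  ext T hT
  rw [Measure.add_apply, E.scalarMeasure_apply _ hT, E.scalarMeasure_apply _ hT,
    E.scalarMeasure_apply _ hT, ← ENNReal.ofReal_add (by positivity) (by positivity)]
  congr 1
  rw [map_add, map_smul, E.proj_proj hT hS, E.proj_proj hT hS.compl]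
  have h : ⟪E.proj (T ∩ S) x, ω • E.proj (T ∩ Sᶜ) y⟫_ℂ = 0 := by
    rw [inner_smul_right, E.inner_proj_proj_of_disjoint (hT.inter hS) (hT.inter hS.compl), mul_zero]
    exact disjoint_compl_right.mono Set.inter_subset_right Set.inter_subset_right
  have h2 := norm_add_sq_eq_norm_sq_add_norm_sq_of_inner_eq_zero _ _ h
  rw [norm_smul, hω, one_mul] at h2
  simpa [sq] using h2

end ProjectionValuedMeasure

namespace IsSpectralMeasureOf

variable {H : Type*} [NormedAddCommGroup H] [InnerProductSpace ℂ H] [CompleteSpace H]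
  {A : H →ₗ.[ℂ] H} {E : ProjectionValuedMeasure H}

theorem inner_of_mem_graph (hE : IsSpectralMeasureOf A E) {x y : H} (h : (x, y) ∈ A.graph) :
    ⟪x, y⟫_ℂ = ((∫ l : ℝ, l ∂(E.scalarMeasure x) : ℝ) : ℂ) := by
  rw [LinearPMap.mem_graph_iff] at h
  obtain ⟨a, rfl, rfl⟩ := h
  exact hE.inner_apply a

theorem proj_mem_domain (hE : IsSpectralMeasureOf A E) {S : Set ℝ} (hS : MeasurableSet S) {x : H}
    (hx : x ∈ A.domain) : E.proj S x ∈ A.domain := by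
  rw [hE.mem_domain_iff] at hx ⊢
  rw [E.scalarMeasure_proj hS]
  exact hx.restrict

theorem mem_domain_of_bounded (hE : IsSpectralMeasureOf A E) {S : Set ℝ} (hS : MeasurableSet S)
    {R : ℝ} (hR : ∀ l ∈ S, |l| ≤ R) (x : H) : E.proj S x ∈ A.domain := by
  rw [hE.mem_domain_iff, E.scalarMeasure_proj hS]
  refine Integrable.of_bound (by fun_prop) (R ^ 2) ?_
  filter_upwards [ae_restrict_mem hS] with l hl
  rw [norm_pow, Real.norm_eq_abs]
  exact pow_le_pow_left₀ (abs_nonneg l) (hR l hl) 2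

/-- The spectral measure is tied to `A` only through quadratic forms. The scalar measure of a sum
from complementary ranges ignores the relative phase, hence so does the form of `A`; comparing the
phases `1, -1` and `i, -i` kills the cross terms. -/
theorem inner_proj_compl_eq_zero (hE : IsSpectralMeasureOf A E) {S : Set ℝ}
    (hS : MeasurableSet S) {x y X Y : H} (hX : (E.proj S x, X) ∈ A.graph)
    (hY : (E.proj Sᶜ y, Y) ∈ A.graph) : ⟪E.proj S x, Y⟫_ℂ = 0 := by
  have key : ∀ ω : ℂ, ‖ω‖ = 1 → ⟪E.proj S x + ω • E.proj Sᶜ y, X + ω • Y⟫_ℂ =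
      ((∫ l : ℝ, l ∂(E.scalarMeasure (E.proj S x) + E.scalarMeasure (E.proj Sᶜ y)) : ℝ) : ℂ) := by
    intro ω hω
    rw [← E.scalarMeasure_add_smul hS x y hω]
    exact hE.inner_of_mem_graph (A.graph.add_mem hX (A.graph.smul_mem ω hY))
  have h1 := key 1 (by simp)
  have h2 := key (-1) (by simp)
  have h3 := key Complex.I (by simp)
  have h4 := key (-Complex.I) (by simp)
  rw [← h2] at h1
  rw [← h4] at h3
  simp only [inner_add_left, inner_add_right, inner_smul_left, inner_smul_right, map_one, map_neg,
    Complex.conj_I] at h1 h3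
  have h5 : ⟪E.proj S x, Y⟫_ℂ + ⟪E.proj Sᶜ y, X⟫_ℂ = 0 := by linear_combination h1 / 2
  have h6 : Complex.I * (⟪E.proj S x, Y⟫_ℂ - ⟪E.proj Sᶜ y, X⟫_ℂ) = 0 := by
    linear_combination h3 / 2
  have h7 := (mul_eq_zero.1 h6).resolve_left Complex.I_ne_zero
  linear_combination (h5 + h7) / 2

theorem proj_proj_compl_eq_zero (hA : IsSelfAdjoint A) (hE : IsSpectralMeasureOf A E) {S : Set ℝ}
    (hS : MeasurableSet S) {y Y : H} (hY : (E.proj Sᶜ y, Y) ∈ A.graph) : E.proj S Y = 0 := by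
  refine hA.dense_domain.eq_zero_of_inner_right ℂ fun v hv => ?_
  rw [← E.inner_proj_left hS]
  exact inner_proj_compl_eq_zero hE hS (A.mem_graph ⟨_, hE.proj_mem_domain hS hv⟩) hY

/-- The spectral projections commute with the operator. -/
theorem proj_mem_graph (hA : IsSelfAdjoint A) (hE : IsSpectralMeasureOf A E) {S : Set ℝ}
    (hS : MeasurableSet S) {x y : H} (h : (x, y) ∈ A.graph) :
    (E.proj S x, E.proj S y) ∈ A.graph := by
  have hx : x ∈ A.domain := LinearPMap.mem_domain_of_mem_graph h
  set Y₁ := A ⟨_, hE.proj_mem_domain hS hx⟩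
  set Y₂ := A ⟨_, hE.proj_mem_domain hS.compl hx⟩
  have h₁ : (E.proj S x, Y₁) ∈ A.graph := A.mem_graph ⟨_, hE.proj_mem_domain hS hx⟩
  have h₂ : (E.proj Sᶜ x, Y₂) ∈ A.graph := A.mem_graph ⟨_, hE.proj_mem_domain hS.compl hx⟩
  have e₂ := proj_proj_compl_eq_zero hA hE hS h₂
  have e₁ := proj_proj_compl_eq_zero hA hE hS.compl (y := x) (Y := Y₁) (by rwa [compl_compl])
  have h₃ := A.graph.add_mem h₁ h₂
  rw [Prod.mk_add_mk, E.proj_compl hS, add_sub_cancel] at h₃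
  have e₃ : y = Y₁ + Y₂ := A.mem_graph_snd_inj h h₃ rfl
  rw [E.proj_compl hS, sub_eq_zero] at e₁
  rwa [e₃, map_add, e₂, ← e₁, add_zero]

/-- For a symmetric operator the numerical radius bounds the norm: apply `|⟪v, Av⟫| ≤ R‖v‖²` to `v =
x ± R⁻¹Ax`, subtract, and use the parallelogram law. -/
theorem norm_le_of_mem_graph (hA : IsSelfAdjoint A) (hE : IsSpectralMeasureOf A E) {S : Set ℝ}
    (hS : MeasurableSet S) {R : ℝ} (hR0 : 0 < R) (hR : ∀ l ∈ S, |l| ≤ R) {x y : H}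
    (hx : E.proj S x = x) (h : (x, y) ∈ A.graph) : ‖y‖ ≤ R * ‖x‖ := by
  have hq : ∀ {x y : H}, E.proj S x = x → (x, y) ∈ A.graph →
      |RCLike.re ⟪x, y⟫_ℂ| ≤ R * ‖x‖ ^ 2 := by
    intro x y hx h
    rw [hE.inner_of_mem_graph h, ← hx, E.scalarMeasure_proj hS]
    rw [RCLike.re_to_complex, Complex.ofReal_re, ← Real.norm_eq_abs]
    have := norm_setIntegral_le_of_norm_le_const (μ := E.scalarMeasure x) (s := S)
      (f := fun l : ℝ => l) (C := R) (measure_lt_top _ _) hR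
    rwa [measureReal_def, E.scalarMeasure_apply _ hS, ENNReal.toReal_ofReal (by positivity)] at this
  have hy : E.proj S y = y := by
    have := proj_mem_graph hA hE hS h
    rw [hx] at this
    exact A.mem_graph_snd_inj this h rfl
  obtain ⟨z, hz⟩ : ∃ z, (y, z) ∈ A.graph :=
    ⟨_, A.mem_graph ⟨y, hy ▸ hE.mem_domain_of_bounded hS hR y⟩⟩
  have h1 := hq (x := x + ((R⁻¹ : ℝ) : ℂ) • y) (by rw [map_add, map_smul, hx, hy])
    (A.graph.add_mem h (A.graph.smul_mem ((R⁻¹ : ℝ) : ℂ) hz))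
  have h2 := hq (x := x - ((R⁻¹ : ℝ) : ℂ) • y) (by rw [map_sub, map_smul, hx, hy])
    (A.graph.sub_mem h (A.graph.smul_mem ((R⁻¹ : ℝ) : ℂ) hz))
  have h3 : ⟪x, z⟫_ℂ = ⟪y, y⟫_ℂ := (LinearPMap.inner_eq_of_mem_graph hA h hz).symm
  have hp := parallelogram_law_with_norm ℂ x (((R⁻¹ : ℝ) : ℂ) • y)
  rw [norm_smul, Complex.norm_real, Real.norm_of_nonneg (by positivity)] at hp
  have h4 := (le_abs_self _).trans h1
  have h5 := (neg_le_abs _).trans h2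
  simp only [Prod.smul_mk, inner_add_left, inner_add_right, inner_sub_left, inner_sub_right,
    inner_smul_left, inner_smul_right, Complex.conj_ofReal, h3, map_add, map_sub,
    RCLike.re_to_complex, Complex.add_re, Complex.sub_re, Complex.re_ofReal_mul] at h4 h5
  have h6 : Complex.re ⟪y, y⟫_ℂ = ‖y‖ ^ 2 := inner_self_eq_norm_sq (𝕜 := ℂ) y
  rw [h6] at h4 h5
  have h7 : 4 * (R⁻¹ * ‖y‖ ^ 2) ≤ R * (2 * (‖x‖ ^ 2 + (R⁻¹ * ‖y‖) ^ 2)) := by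
    rw [← hp]; linarith
  have h8 : ‖y‖ ^ 2 ≤ (R * ‖x‖) ^ 2 := by
    have : R * R⁻¹ = 1 := mul_inv_cancel₀ hR0.ne'
    have e : R * (R⁻¹ * ‖y‖ ^ 2) = ‖y‖ ^ 2 := by rw [← mul_assoc, this, one_mul]
    have e2 : R * (R * (R⁻¹ * ‖y‖) ^ 2) = ‖y‖ ^ 2 := by
      rw [mul_pow]; field_simp
    nlinarith [mul_le_mul_of_nonneg_left h7 hR0.le]
  exact le_of_sq_le_sq h8 (by positivity)

theorem mul_norm_le_of_mem_graph_of_sign (hE : IsSpectralMeasureOf A E) {S : Set ℝ}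
    (hS : MeasurableSet S) {R σ : ℝ} (hσ : |σ| = 1) (hR : ∀ l ∈ S, R ≤ σ * l) {x y : H}
    (hx : E.proj S x = x) (h : (x, y) ∈ A.graph) : R * ‖x‖ ≤ ‖y‖ := by
  have hi : Integrable (fun l : ℝ => σ * l) (E.scalarMeasure x) := by
    have h1 := (hE.mem_domain_iff x).1 (LinearPMap.mem_domain_of_mem_graph h)
    refine Integrable.mono' (h1.add (integrable_const (1 : ℝ))) (by fun_prop) ?_
    refine Eventually.of_forall fun l => ?_
    rw [norm_mul, Real.norm_eq_abs, hσ, one_mul, Real.norm_eq_abs, Pi.add_apply]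
    nlinarith [sq_nonneg (|l| - 1), sq_abs l, abs_nonneg l]
  have h1 : R * ‖x‖ ^ 2 ≤ σ * RCLike.re ⟪x, y⟫_ℂ := by
    have h2 := setIntegral_ge_of_const_le (μ := E.scalarMeasure x) hS (measure_ne_top _ _) hR
      hi.integrableOn
    rw [measureReal_def, E.scalarMeasure_apply _ hS, ENNReal.toReal_ofReal (by positivity), hx,
      integral_const_mul] at h2
    rw [hE.inner_of_mem_graph h, RCLike.re_to_complex, Complex.ofReal_re]
    conv_rhs => rw [← hx, E.scalarMeasure_proj hS]
    rwa [smul_eq_mul, mul_comm] at h2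
  have h3 : σ * RCLike.re ⟪x, y⟫_ℂ ≤ ‖x‖ * ‖y‖ := by
    calc σ * RCLike.re ⟪x, y⟫_ℂ ≤ |σ * RCLike.re ⟪x, y⟫_ℂ| := le_abs_self _
      _ = |RCLike.re ⟪x, y⟫_ℂ| := by rw [abs_mul, hσ, one_mul]
      _ ≤ ‖⟪x, y⟫_ℂ‖ := RCLike.abs_re_le_norm _
      _ ≤ _ := norm_inner_le_norm _ _
  rcases (norm_nonneg x).eq_or_lt with h0 | h0
  · rw [← h0]; simp
  · by_contra! hlt
    nlinarith

/-- The form of `A` could cancel between the positive and negative parts of the spectrum, so the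
vector is split at `0`. On each half the form has a sign and Cauchy–Schwarz suffices; the halves are
orthogonal. -/
theorem mul_norm_le_of_mem_graph (hA : IsSelfAdjoint A) (hE : IsSpectralMeasureOf A E) {S : Set ℝ}
    (hS : MeasurableSet S) {R : ℝ} (hR0 : 0 ≤ R) (hR : ∀ l ∈ S, R ≤ |l|) {x y : H}
    (hx : E.proj S x = x) (h : (x, y) ∈ A.graph) : R * ‖x‖ ≤ ‖y‖ := by
  have hT : MeasurableSet (Set.Ici (0 : ℝ)) := measurableSet_Ici
  have key : ∀ (T : Set ℝ) (σ : ℝ), MeasurableSet T → |σ| = 1 → (∀ l ∈ T, |l| = σ * l) →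
      R * ‖E.proj T x‖ ≤ ‖E.proj T y‖ := by
    intro T σ hT hσ hl
    refine hE.mul_norm_le_of_mem_graph_of_sign (hT.inter hS) hσ (fun l hl' => ?_) ?_
      (proj_mem_graph hA hE hT h)
    · rw [← hl l hl'.1]; exact hR l hl'.2
    · conv_lhs => rw [← hx]
      conv_rhs => rw [← hx]
      rw [E.proj_proj hT hS, E.proj_proj (hT.inter hS) (hT.inter hS), Set.inter_self]
  have h1 := key (Set.Ici 0) 1 hT (by simp) fun l hl => by
    rw [abs_of_nonneg hl, one_mul]
  have h2 := key (Set.Ici 0)ᶜ (-1) hT.compl (by simp) fun l hl => by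
    rw [abs_of_neg (by simpa using hl), neg_one_mul]
  have h3 := E.norm_sq_eq_add_compl hT x
  have h4 := E.norm_sq_eq_add_compl hT y
  have h5 := mul_self_le_mul_self (by positivity) h1
  have h6 := mul_self_le_mul_self (by positivity) h2
  refine le_of_sq_le_sq (b := ‖y‖) ?_ (norm_nonneg _)
  rw [mul_pow, h3, h4]
  nlinarith

section Inverse

open LinearPMap (IsInvOneAddSq)

variable {S₀ : H →L[ℂ] H} {S : Set ℝ} {R : ℝ} {x : H}

theorem commute_proj (hA : IsSelfAdjoint A) (hE : IsSpectralMeasureOf A E)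
    (hS₀ : IsInvOneAddSq A S₀) (hS : MeasurableSet S) : Commute S₀ (E.proj S) :=
  (IsInvOneAddSq.comp_eq hA hS₀ hS₀ (E.proj S) fun _ _ h => proj_mem_graph hA hE hS h).symm

/-- Both the form of `S₀` and `‖x‖²` are expressed through `S₀ x`, `z = A S₀ x` and `A z = x - S₀
x`. Bounds for `A` at the two vectors `S₀ x` and `z`, which stay in the spectral subspace, then
compare them up to the factor `1 + R²`. -/
theorem exists_mem_graph_of_proj_eq (hA : IsSelfAdjoint A) (hE : IsSpectralMeasureOf A E)
    (hS₀ : IsInvOneAddSq A S₀) (hS : MeasurableSet S) (hx : E.proj S x = x) :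
    ∃ z, (S₀ x, z) ∈ A.graph ∧ (z, x - S₀ x) ∈ A.graph ∧ E.proj S (S₀ x) = S₀ x ∧
      E.proj S z = z ∧ RCLike.re ⟪S₀ x, x⟫_ℂ = ‖S₀ x‖ ^ 2 + ‖z‖ ^ 2 ∧
      ‖x‖ ^ 2 = ‖S₀ x‖ ^ 2 + 2 * ‖z‖ ^ 2 + ‖x - S₀ x‖ ^ 2 := by
  obtain ⟨z, h₁, h₂⟩ := hS₀ x
  have h₃ : E.proj S (S₀ x) = S₀ x := by
    have := congrArg (fun T : H →L[ℂ] H => T x) (commute_proj hA hE hS₀ hS)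
    simpa [hx] using this.symm
  have h₄ := proj_mem_graph hA hE hS h₁
  rw [h₃] at h₄
  have h₅ := IsInvOneAddSq.inner_self hA h₁ h₂
  refine ⟨z, h₁, h₂, h₃, A.mem_graph_snd_inj h₄ h₁ rfl, h₅, ?_⟩
  have h₆ := norm_sub_sq (𝕜 := ℂ) x (S₀ x)
  rw [← inner_conj_symm, RCLike.conj_re, h₅] at h₆
  linarith

theorem le_re_inner_of_proj_eq (hA : IsSelfAdjoint A) (hE : IsSpectralMeasureOf A E)
    (hS₀ : IsInvOneAddSq A S₀) (hS : MeasurableSet S) (hR0 : 0 < R) (hR : ∀ l ∈ S, |l| ≤ R)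
    (hx : E.proj S x = x) : (1 + R ^ 2)⁻¹ * ‖x‖ ^ 2 ≤ RCLike.re ⟪S₀ x, x⟫_ℂ := by
  obtain ⟨z, h₁, h₂, h₃, h₄, h₅, h₆⟩ := exists_mem_graph_of_proj_eq hA hE hS₀ hS hx
  have h₇ := pow_le_pow_left₀ (norm_nonneg _) (norm_le_of_mem_graph hA hE hS hR0 hR h₃ h₁) 2
  have h₈ := pow_le_pow_left₀ (norm_nonneg _) (norm_le_of_mem_graph hA hE hS hR0 hR h₄ h₂) 2
  rw [h₅, inv_mul_le_iff₀ (by positivity), h₆]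
  nlinarith

theorem re_inner_le_of_proj_eq (hA : IsSelfAdjoint A) (hE : IsSpectralMeasureOf A E)
    (hS₀ : IsInvOneAddSq A S₀) (hS : MeasurableSet S) (hR0 : 0 ≤ R) (hR : ∀ l ∈ S, R ≤ |l|)
    (hx : E.proj S x = x) : RCLike.re ⟪S₀ x, x⟫_ℂ ≤ (1 + R ^ 2)⁻¹ * ‖x‖ ^ 2 := by
  obtain ⟨z, h₁, h₂, h₃, h₄, h₅, h₆⟩ := exists_mem_graph_of_proj_eq hA hE hS₀ hS hx
  have h₇ := pow_le_pow_left₀ (by positivity) (mul_norm_le_of_mem_graph hA hE hS hR0 hR h₃ h₁) 2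
  have h₈ := pow_le_pow_left₀ (by positivity) (mul_norm_le_of_mem_graph hA hE hS hR0 hR h₄ h₂) 2
  rw [h₅, le_inv_mul_iff₀ (by positivity), h₆]
  nlinarith

/-- Since `|l| ≤ R` means `(1 + l²)⁻¹ ≥ (1 + R²)⁻¹`, every cutoff is the identity on the range of
`E([-R,R])`. The complement is exhausted by the sets `|l| ≥ R + 1/(k+1)`; the gap makes the cutoffs
vanish there for large `n`, and contractivity controls the remainder. -/
theorem tendsto_cfc_cutoff (hA : IsSelfAdjoint A) (hE : IsSpectralMeasureOf A E)
    (hS₀ : IsInvOneAddSq A S₀) (hR0 : 0 < R) (x : H) :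
    Tendsto (fun n => cfc (cutoff (1 + R ^ 2)⁻¹ n) S₀ x) atTop (𝓝 (E.proj (Set.Icc (-R) R) x)) := by
  have hsa := hS₀.isSelfAdjoint hA
  have hI : MeasurableSet (Set.Icc (-R) R) := measurableSet_Icc
  let T : ℕ → Set ℝ := fun k => {l | R + 1 / (k + 1) ≤ |l|}
  have hT : ∀ k, MeasurableSet (T k) := fun k => measurableSet_le measurable_const (by fun_prop)
  have hTmem : ∀ k l, l ∈ T k ↔ R + 1 / ((k : ℝ) + 1) ≤ |l| := fun k l => by simp [T]
  have hTm : Monotone T := fun k m hkm l hl => by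
    rw [hTmem] at hl ⊢
    refine le_trans ?_ hl
    gcongr
  have hTU : ⋃ k, T k = (Set.Icc (-R) R)ᶜ := by
    ext l
    rw [Set.mem_iUnion, Set.mem_compl_iff, Set.mem_Icc, ← abs_le, not_le]
    constructor
    · rintro ⟨k, hk⟩
      rw [hTmem] at hk
      have : (0 : ℝ) < 1 / (k + 1) := by positivity
      linarith
    · intro hl
      obtain ⟨k, hk⟩ := exists_nat_one_div_lt (sub_pos.2 hl)
      exact ⟨k, (hTmem k l).2 (by linarith)⟩
  have hlim := E.tendsto_proj_of_monotone hT hTm x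
  rw [hTU] at hlim
  have h1 : ∀ n, cfc (cutoff (1 + R ^ 2)⁻¹ n) S₀ x =
      E.proj (Set.Icc (-R) R) x + cfc (cutoff (1 + R ^ 2)⁻¹ n) S₀ (E.proj (Set.Icc (-R) R)ᶜ x) := by
    intro n
    have h2 : cfc (cutoff (1 + R ^ 2)⁻¹ n) S₀ (E.proj (Set.Icc (-R) R) x) =
        E.proj (Set.Icc (-R) R) x := by
      refine ContinuousLinearMap.cfc_cutoff_apply_of_le hsa (E.isStarProjection _ hI)
        (commute_proj hA hE hS₀ hI) (fun y hy => le_re_inner_of_proj_eq hA hE hS₀ hI hR0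
          (fun l hl => abs_le.2 hl) hy) n ?_
      rw [E.proj_proj hI hI, Set.inter_self]
    conv_rhs => rw [E.proj_compl hI, map_sub, h2, add_sub_cancel]
  simp only [h1]
  have h3 : Tendsto (fun n => cfc (cutoff (1 + R ^ 2)⁻¹ n) S₀ (E.proj (Set.Icc (-R) R)ᶜ x)) atTop
      (𝓝 0) := by
    rw [Metric.tendsto_atTop] at hlim ⊢
    intro ε hε
    obtain ⟨k, hk⟩ := hlim ε hε
    have hk := hk k le_rfl
    have hc : (1 + (R + 1 / ((k : ℝ) + 1)) ^ 2)⁻¹ < (1 + R ^ 2)⁻¹ := by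
      gcongr
      have : (0 : ℝ) < 1 / (k + 1) := by positivity
      linarith
    obtain ⟨N, hN⟩ := exists_nat_gt (((1 + R ^ 2)⁻¹ - (1 + (R + 1 / ((k : ℝ) + 1)) ^ 2)⁻¹)⁻¹)
    refine ⟨N, fun n hn => ?_⟩
    have h4 : cfc (cutoff (1 + R ^ 2)⁻¹ n) S₀ (E.proj (T k) x) = 0 := by
      refine ContinuousLinearMap.cfc_cutoff_apply_of_ge hsa (E.isStarProjection _ (hT k))
        (commute_proj hA hE hS₀ (hT k)) (fun y hy => re_inner_le_of_proj_eq hA hE hS₀ (hT k)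
          (by positivity) (fun l hl => (hTmem k l).1 hl) hy) (n := n) ?_ ?_
      · have hn' : (N : ℝ) ≤ n := by exact_mod_cast hn
        rw [← div_le_iff₀ (sub_pos.2 hc), one_div]
        linarith
      · rw [E.proj_proj (hT k) (hT k), Set.inter_self]
    rw [dist_zero_right]
    calc _ = ‖cfc (cutoff (1 + R ^ 2)⁻¹ n) S₀ (E.proj (Set.Icc (-R) R)ᶜ x - E.proj (T k) x)‖ := by
          rw [map_sub, h4, sub_zero]
      _ ≤ ‖E.proj (Set.Icc (-R) R)ᶜ x - E.proj (T k) x‖ :=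
        ContinuousLinearMap.norm_cfc_cutoff_apply_le _ _ _ _
      _ < ε := by rwa [← dist_eq_norm, dist_comm]
  simpa using h3.const_add (E.proj (Set.Icc (-R) R) x)

end Inverse

end IsSpectralMeasureOf

/-! ### The unitary group seen in both norms. -/

namespace IsUnitaryGroupGeneratedBy

variable {H : Type*} [NormedAddCommGroup H] [InnerProductSpace ℂ H] [CompleteSpace H]
  {A : H →ₗ.[ℂ] H} {U : ℝ → H →L[ℂ] H}

theorem norm_apply (hU : IsUnitaryGroupGeneratedBy A U) (t : ℝ) (x : H) : ‖U t x‖ = ‖x‖ :=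
  ContinuousLinearMap.norm_map_of_mem_unitary (hU.mem_unitary t) x

theorem apply_apply (hU : IsUnitaryGroupGeneratedBy A U) (s t : ℝ) (x : H) :
    U s (U t x) = U (s + t) x := by
  rw [hU.add]; rfl

theorem zero_apply (hU : IsUnitaryGroupGeneratedBy A U) (x : H) : U 0 x = x := by
  rw [hU.zero]; rfl

theorem apply_mem_graph (hU : IsUnitaryGroupGeneratedBy A U) (t : ℝ) {x y : H}
    (h : (x, y) ∈ A.graph) : (U t x, U t y) ∈ A.graph := by
  obtain ⟨a, rfl, rfl⟩ := A.mem_graph_iff.1 h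
  have h1 : HasDerivAt (fun s => U s (a : H)) (-(Complex.I • A a)) 0 :=
    (hU.hasDerivAt_iff _ _).2 ⟨a.2, rfl⟩
  have h2 : HasDerivAt (fun s => U s (U t a)) (U t (-(Complex.I • A a))) 0 := by
    have := ((U t).restrictScalars ℝ).hasFDerivAt.comp_hasDerivAt (0 : ℝ) h1
    refine this.congr_of_eventuallyEq (Eventually.of_forall fun s => ?_)
    change U s (U t a) = U t (U s a)
    rw [hU.apply_apply, hU.apply_apply, add_comm]
  obtain ⟨hx, hy⟩ := (hU.hasDerivAt_iff _ _).1 h2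
  rw [map_neg, neg_inj, map_smul] at hy
  rw [smul_right_injective _ Complex.I_ne_zero hy]
  exact A.mem_graph ⟨_, hx⟩

theorem hasDerivAt_apply (hU : IsUnitaryGroupGeneratedBy A U) (t : ℝ) {x y : H}
    (h : (x, y) ∈ A.graph) : HasDerivAt (fun s => U s x) (-(Complex.I • U t y)) t := by
  obtain ⟨a, rfl, rfl⟩ := A.mem_graph_iff.1 h
  have h1 : HasDerivAt (fun s => U s (a : H)) (-(Complex.I • A a)) 0 :=
    (hU.hasDerivAt_iff _ _).2 ⟨a.2, rfl⟩
  rw [← sub_self t] at h1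
  have h2 := ((U t).restrictScalars ℝ).hasFDerivAt.comp_hasDerivAt t (h1.comp_sub_const t t)
  have h3 : (U t).restrictScalars ℝ (-(Complex.I • A a)) = -(Complex.I • U t (A a)) := by
    change U t _ = _
    rw [map_neg, map_smul]
  rw [h3] at h2
  refine h2.congr_of_eventuallyEq (Eventually.of_forall fun s => ?_)
  change U s a = U t (U (s - t) a)
  rw [hU.apply_apply, add_sub_cancel]

/-- Joint continuity of a strongly continuous unitary group. -/
theorem continuous_apply (hU : IsUnitaryGroupGeneratedBy A U) :
    Continuous fun p : ℝ × H => U p.1 p.2 := by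
  rw [continuous_iff_continuousAt]
  rintro ⟨t, x⟩
  have h1 : Tendsto (fun p : ℝ × H => U p.1 x) (𝓝 (t, x)) (𝓝 (U t x)) :=
    ((hU.continuous x).comp continuous_fst).tendsto (t, x)
  have h2 : Tendsto (fun p : ℝ × H => U p.1 (p.2 - x)) (𝓝 (t, x)) (𝓝 0) := by
    rw [tendsto_zero_iff_norm_tendsto_zero]
    simp only [hU.norm_apply]
    have : Continuous fun p : ℝ × H => ‖p.2 - x‖ := by fun_prop
    simpa using this.tendsto (t, x)
  have h3 := h1.add h2
  simpa [ContinuousAt, ← map_add] using h3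

variable {K : Type*} [NormedAddCommGroup K] [InnerProductSpace ℂ K] [CompleteSpace K]
  {A₀ : K →ₗ.[ℂ] K} {ι : H →L[ℂ] K}

theorem hasDerivAt_map_apply {K : Type*} [NormedAddCommGroup K] [InnerProductSpace ℂ K]
    (hU : IsUnitaryGroupGeneratedBy A U) (ι : H →L[ℂ] K) (t : ℝ) {x y : H}
    (h : (x, y) ∈ A.graph) : HasDerivAt (fun s => ι (U s x)) (-(Complex.I • ι (U t y))) t := by
  have h1 := (ι.restrictScalars ℝ).hasFDerivAt.comp_hasDerivAt t (hU.hasDerivAt_apply t h)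
  have h2 : (ι.restrictScalars ℝ) (-(Complex.I • U t y)) = -(Complex.I • ι (U t y)) := by
    change ι _ = _
    rw [map_neg, map_smul]
  rw [h2] at h1
  exact h1

/-- The group is isometric for the norm of the larger space if the generator has a self-adjoint
extension there. -/
theorem norm_map_apply (hU : IsUnitaryGroupGeneratedBy A U) (hA : IsSelfAdjoint A)
    (hA₀ : IsSelfAdjoint A₀) (hι : ∀ x y, (x, y) ∈ A.graph → (ι x, ι y) ∈ A₀.graph)
    (t : ℝ) (x : H) : ‖ι (U t x)‖ = ‖ι x‖ := by
  refine hA.dense_domain.induction (P := fun x => ‖ι (U t x)‖ = ‖ι x‖) (fun x hx => ?_)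
    (isClosed_eq (by fun_prop) (by fun_prop)) x
  have hg := A.mem_graph ⟨x, hx⟩
  set y := A ⟨x, hx⟩
  -- Symmetry of the extension along the orbit makes the squared norm in the larger space constant.
  have hd : ∀ t, HasDerivAt (fun s => ⟪ι (U s x), ι (U s x)⟫_ℂ) 0 t := by
    intro t
    have h2 := hU.hasDerivAt_map_apply ι t hg
    have h3 := h2.inner ℂ h2
    have hs := LinearPMap.inner_eq_of_mem_graph hA₀ (hι _ _ (hU.apply_mem_graph t hg))
      (hι _ _ (hU.apply_mem_graph t hg))
    have h4 : ⟪ι (U t x), -(Complex.I • ι (U t y))⟫_ℂ + ⟪-(Complex.I • ι (U t y)), ι (U t x)⟫_ℂ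
        = 0 := by
      simp only [inner_neg_left, inner_neg_right, inner_smul_left, inner_smul_right,
        Complex.conj_I]
      rw [hs]; ring
    exact h4 ▸ h3
  have h := is_const_of_deriv_eq_zero (fun t => (hd t).differentiableAt) (fun t => (hd t).deriv) t 0
  simp only [hU.zero_apply, inner_self_eq_norm_sq_to_K] at h
  have h' : ‖ι (U t x)‖ ^ 2 = ‖ι x‖ ^ 2 := by exact_mod_cast h
  exact (pow_left_inj₀ (norm_nonneg _) (norm_nonneg _) two_ne_zero).1 h'

-- On the dense domain the derivative at time `s` has norm `‖A₀ ι U(s)x‖ ≤ C‖U(s)x‖ = C‖x‖`; the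
-- mean value inequality and density conclude. The stronger norm on the right pays for the
-- generator.
omit [CompleteSpace K] in
theorem norm_map_apply_sub_le (hU : IsUnitaryGroupGeneratedBy A U) (hA : IsSelfAdjoint A)
    (hι : ∀ x y, (x, y) ∈ A.graph → (ι x, ι y) ∈ A₀.graph)
    {C : ℝ} (hC : ∀ x y, (ι x, y) ∈ A₀.graph → ‖y‖ ≤ C * ‖x‖) (t : ℝ) (x : H) :
    ‖ι (U t x) - ι x‖ ≤ C * |t| * ‖x‖ := by
  refine hA.dense_domain.induction (P := fun x => ‖ι (U t x) - ι x‖ ≤ C * |t| * ‖x‖) (fun x hx => ?_)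
    (isClosed_le (by fun_prop) (by fun_prop)) x
  have hg := A.mem_graph ⟨x, hx⟩
  set y := A ⟨x, hx⟩
  have h2 : ∀ t ∈ Set.univ, HasDerivWithinAt (fun s => ι (U s x)) (-(Complex.I • ι (U t y)))
      Set.univ t := by
    intro t _
    exact (hU.hasDerivAt_map_apply ι t hg).hasDerivWithinAt
  have h3 := Convex.norm_image_sub_le_of_norm_hasDerivWithin_le h2 (C := C * ‖x‖) (fun t _ => by
    rw [norm_neg, norm_smul, Complex.norm_I, one_mul, ← hU.norm_apply t x]
    exact hC _ _ (hι _ _ (hU.apply_mem_graph t hg))) convex_univ (Set.mem_univ 0) (Set.mem_univ t)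
  simp only [hU.zero_apply, sub_zero, Real.norm_eq_abs] at h3
  linarith

end IsUnitaryGroupGeneratedBy

/-! ### Spectral truncations restricted to the smaller space. -/

namespace LinearPMap

variable {H K : Type*} [NormedAddCommGroup H] [InnerProductSpace ℂ H] [CompleteSpace H]
  [NormedAddCommGroup K] [InnerProductSpace ℂ K] [CompleteSpace K]
  {A : H →ₗ.[ℂ] H} {A₀ : K →ₗ.[ℂ] K} {ι : H →L[ℂ] K}

/-- A closed operator is bounded on a continuously embedded Banach space inside its domain. -/
theorem exists_norm_le_of_forall_mem_domain (hA₀ : A₀.IsClosed) (hdom : ∀ x, ι x ∈ A₀.domain) :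
    ∃ C, 0 ≤ C ∧ ∀ x y, (ι x, y) ∈ A₀.graph → ‖y‖ ≤ C * ‖x‖ := by
  let T : H →ₗ[ℂ] K := A₀.toFun.comp ((ι : H →ₗ[ℂ] K).codRestrict A₀.domain hdom)
  have hT : ∀ x, (ι x, T x) ∈ A₀.graph := fun x => A₀.mem_graph ⟨ι x, hdom x⟩
  have hc : Continuous T := by
    refine T.continuous_of_seq_closed_graph fun u x y hu hTu => ?_
    have h1 : Tendsto (fun n => (ι (u n), T (u n))) atTop (𝓝 (ι x, y)) :=
      ((ι.continuous.tendsto x).comp hu).prodMk_nhds hTu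
    have h2 : (ι x, y) ∈ A₀.graph :=
      _root_.IsClosed.mem_of_tendsto hA₀ h1 (Eventually.of_forall fun n => hT (u n))
    exact A₀.mem_graph_snd_inj h2 (hT x) rfl
  let T' : H →L[ℂ] K := ⟨T, hc⟩
  refine ⟨‖T'‖, norm_nonneg _, fun x y h => ?_⟩
  rw [A₀.mem_graph_snd_inj h (hT x) rfl]
  exact T'.le_opNorm x

/-- The spectral projections of the extension restrict to contractions of the smaller space. -/
theorem exists_spectral_truncation (hι : Function.Injective ι) (hA : IsSelfAdjoint A)
    (hA₀ : IsSelfAdjoint A₀) (hg : ∀ x y, (x, y) ∈ A.graph → (ι x, ι y) ∈ A₀.graph)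
    {E : ProjectionValuedMeasure K} (hE : IsSpectralMeasureOf A₀ E) {S : H →L[ℂ] H}
    (hS : IsInvOneAddSq A S) {R : ℝ} (hR : 0 < R) :
    ∃ Q : H →L[ℂ] H, (∀ x, ι (Q x) = E.proj (Set.Icc (-R) R) (ι x)) ∧ (∀ x, ‖Q x‖ ≤ ‖x‖) ∧
      (∀ x, ‖S x - Q (S x)‖ ≤ (1 + R ^ 2)⁻¹ * ‖x‖) ∧
      ∀ J : H →L[ℂ] H, J.comp S = S.comp J → ∀ x, J (Q x) = Q (J x) := by
  obtain ⟨S₀, hS₀⟩ := exists_isInvOneAddSq hA₀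
  have hSS := hS.comp_eq hA₀ hS₀ ι hg
  have hsa := hS.isSelfAdjoint hA
  set c := (1 + R ^ 2)⁻¹
  have hint : ∀ n x, ι (cfc (cutoff c n) S x) = cfc (cutoff c n) S₀ (ι x) := fun n x =>
    congrArg (fun T => T x) (ContinuousLinearMap.comp_cfc_eq hsa (hS₀.isSelfAdjoint hA₀) hSS
      (continuous_cutoff c n))
  choose q hq using ContinuousLinearMap.exists_tendsto_cfc_cutoff S c
  -- The cutoffs converge in the smaller space by monotonicity and in the larger one to the spectral
  -- projection; continuity of `ι` identifies the limits.
  have hιq : ∀ x, ι (q x) = E.proj (Set.Icc (-R) R) (ι x) := by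
    intro x
    have h1 := (ι.continuous.tendsto _).comp (hq x)
    simp only [Function.comp_def, hint] at h1
    exact tendsto_nhds_unique h1 (hE.tendsto_cfc_cutoff hA₀ hS₀ hR (ι x))
  have hn : ∀ x, ‖q x‖ ≤ ‖x‖ := fun x =>
    le_of_tendsto (hq x).norm (Eventually.of_forall fun n =>
      ContinuousLinearMap.norm_cfc_cutoff_apply_le S c n x)
  let Q : H →ₗ[ℂ] H :=
    { toFun := q
      map_add' := fun x y => hι (by rw [_root_.map_add, hιq, hιq, hιq, _root_.map_add, _root_.map_add])
      map_smul' := fun a x => hι (by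
        rw [RingHom.id_apply, _root_.map_smul, hιq, hιq, _root_.map_smul, _root_.map_smul]) }
  refine ⟨Q.mkContinuous 1 fun x => by rw [one_mul]; exact hn x, hιq, hn, fun x => ?_, fun J hJ x => ?_⟩
  · refine le_of_tendsto ((hq (S x)).const_sub (S x)).norm (Eventually.of_forall fun n => ?_)
    exact ContinuousLinearMap.norm_sub_cfc_cutoff_le (hS.nonneg hA) (by positivity) n x
  · have h1 := (J.continuous.tendsto _).comp (hq x)
    refine tendsto_nhds_unique h1 ((hq (J x)).congr fun n => ?_)
    exact (congrArg (fun T => T x) (ContinuousLinearMap.comp_cfc_eq hsa hsa hJ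
      (continuous_cutoff c n))).symm

end LinearPMap

/-- The spectral truncations `Q R = E([-R, R])` restricted to the smaller space, together with a
group that is isometric in both norms. -/
structure IsSplittingFrame {H K : Type*} [NormedAddCommGroup H] [InnerProductSpace ℂ H]
    [NormedAddCommGroup K] [InnerProductSpace ℂ K] (ι : H →L[ℂ] K) (U : ℝ → H →L[ℂ] H)
    (Q : ℝ → H →L[ℂ] H) (C : ℝ) : Prop where
  nonneg : 0 ≤ C
  zero_apply : ∀ x, U 0 x = x
  apply_apply : ∀ s t x, U s (U t x) = U (s + t) x
  continuous_apply : Continuous fun p : ℝ × H => U p.1 p.2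
  norm_apply : ∀ t x, ‖U t x‖ = ‖x‖
  norm_map_apply : ∀ t x, ‖ι (U t x)‖ = ‖ι x‖
  norm_map_apply_sub_le : ∀ t x, ‖ι (U t x - x)‖ ≤ C * |t| * ‖x‖
  norm_trunc_le : ∀ R, 0 < R → ∀ x, ‖Q R x‖ ≤ ‖x‖
  norm_map_trunc_le : ∀ R, 0 < R → ∀ x, ‖ι (Q R x)‖ ≤ ‖ι x‖
  norm_map_trunc_sub_le : ∀ R, 0 < R → ∀ x, ‖ι (Q R x - x)‖ ≤ C / R * ‖x‖
  trunc_trunc : ∀ R, 0 < R → ∀ x, Q R (Q R x) = Q R x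
  apply_trunc : ∀ R, 0 < R → ∀ t x, U t (Q R x) = Q R (U t x)
  tendsto_trunc : ∀ x, Tendsto (fun R => Q R x) atTop (𝓝 x)

theorem exists_isSplittingFrame {H K : Type*} [NormedAddCommGroup H] [InnerProductSpace ℂ H]
    [CompleteSpace H] [NormedAddCommGroup K] [InnerProductSpace ℂ K] [CompleteSpace K]
    {A : H →ₗ.[ℂ] H} {A₀ : K →ₗ.[ℂ] K} {ι : H →L[ℂ] K} (hι : Function.Injective ι)
    (hA : IsSelfAdjoint A) (hA₀ : IsSelfAdjoint A₀) (hdom : ∀ x : H, ι x ∈ A₀.domain)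
    (hg : ∀ x y, (x, y) ∈ A.graph → (ι x, ι y) ∈ A₀.graph)
    {U : ℝ → H →L[ℂ] H} (hU : IsUnitaryGroupGeneratedBy A U)
    {E : ProjectionValuedMeasure K} (hE : IsSpectralMeasureOf A₀ E) :
    ∃ Q C, IsSplittingFrame ι U Q C ∧
      ∀ R, 0 < R → ∀ x, ι (Q R x) = E.proj (Set.Icc (-R) R) (ι x) := by
  obtain ⟨S, hS⟩ := LinearPMap.exists_isInvOneAddSq hA
  obtain ⟨C, hC0, hC⟩ := LinearPMap.exists_norm_le_of_forall_mem_domain hA₀.isClosed hdom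
  have hex : ∀ R : ℝ, ∃ Q : H →L[ℂ] H, 0 < R →
      ((∀ x, ι (Q x) = E.proj (Set.Icc (-R) R) (ι x)) ∧ (∀ x, ‖Q x‖ ≤ ‖x‖) ∧
      (∀ x, ‖S x - Q (S x)‖ ≤ (1 + R ^ 2)⁻¹ * ‖x‖) ∧
      ∀ J : H →L[ℂ] H, J.comp S = S.comp J → ∀ x, J (Q x) = Q (J x)) := by
    intro R
    by_cases hR : 0 < R
    · obtain ⟨Q, hQ⟩ := LinearPMap.exists_spectral_truncation hι hA hA₀ hg hE hS hR
      exact ⟨Q, fun _ => hQ⟩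
    · exact ⟨0, fun h => absurd h hR⟩
  choose Q hQ using hex
  have hI : ∀ R : ℝ, MeasurableSet (Set.Icc (-R) R) := fun R => measurableSet_Icc
  refine ⟨Q, C, ?_, fun R hR => (hQ R hR).1⟩
  constructor
  · exact hC0
  · exact hU.zero_apply
  · exact hU.apply_apply
  · exact hU.continuous_apply
  · exact hU.norm_apply
  · exact hU.norm_map_apply hA hA₀ hg
  · intro t x
    rw [map_sub]
    exact hU.norm_map_apply_sub_le hA hg hC t x
  · exact fun R hR => (hQ R hR).2.1
  · intro R hR x
    rw [(hQ R hR).1]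
    exact E.norm_proj_apply_le (hI R) _
  · intro R hR x
    -- With `P' = E([-R,R]ᶜ)`: `R‖P'ιx‖ ≤ ‖A₀P'ιx‖ = ‖P'A₀ιx‖ ≤ C‖x‖`.
    have h1 := IsSpectralMeasureOf.proj_mem_graph hA₀ hE (hI R).compl (A₀.mem_graph ⟨ι x, hdom x⟩)
    have h2 := IsSpectralMeasureOf.mul_norm_le_of_mem_graph hA₀ hE (hI R).compl hR.le
      (fun l hl => by
        rw [Set.mem_compl_iff, Set.mem_Icc, ← abs_le, not_le] at hl
        exact hl.le) (by rw [E.proj_proj (hI R).compl (hI R).compl, Set.inter_self]) h1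
    have h3 := (h2.trans (E.norm_proj_apply_le (hI R).compl _)).trans
      (hC _ _ (A₀.mem_graph ⟨ι x, hdom x⟩))
    rw [map_sub, (hQ R hR).1, norm_sub_rev, ← E.proj_compl (hI R), div_mul_eq_mul_div,
      le_div_iff₀' hR]
    exact h3
  · intro R hR x
    apply hι
    rw [(hQ R hR).1, (hQ R hR).1, E.proj_proj (hI R) (hI R), Set.inter_self]
  · intro R hR t x
    exact (hQ R hR).2.2.2 (U t)
      (LinearPMap.IsInvOneAddSq.comp_eq hA hS hS (U t) fun _ _ h => hU.apply_mem_graph t h) x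
  · intro x
    rw [Metric.tendsto_nhds]
    intro ε hε
    -- On the range of `S` the truncations converge at the rate `(1 + R²)⁻¹`; contractivity extends
    -- convergence to the closure.
    obtain ⟨y, hy⟩ := (hS.denseRange hA).exists_dist_lt x (show 0 < ε / 3 by positivity)
    rw [dist_eq_norm] at hy
    have hlim : Tendsto (fun R : ℝ => (1 + R ^ 2)⁻¹ * ‖y‖) atTop (𝓝 0) := by
      have : Tendsto (fun R : ℝ => 1 + R ^ 2) atTop atTop :=
        tendsto_atTop_add_const_left _ _ (tendsto_pow_atTop two_ne_zero)
      simpa using this.inv_tendsto_atTop.mul_const ‖y‖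
    filter_upwards [eventually_gt_atTop 0, hlim.eventually (gt_mem_nhds (show 0 < ε / 3 by
      positivity))] with R hR hsmall
    have h1 := (hQ R hR).2.2.1 y
    have h2 := (hQ R hR).2.1 (x - S y)
    have h3 : Q R x - x = Q R (x - S y) - (S y - Q R (S y)) - (x - S y) := by
      rw [map_sub]; abel
    rw [dist_eq_norm, h3]
    refine (norm_sub_le _ _).trans_lt ?_
    linarith [norm_sub_le (Q R (x - S y)) (S y - Q R (S y))]

/-! ### Locally Lipschitz fields and their integral curves. -/

section LocallyLipschitz

variable {F : Type*} [NormedAddCommGroup F]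

/-- A locally Lipschitz map is bounded and Lipschitz on balls of a fixed radius around the points
of a compact set. -/
theorem LocallyLipschitz.exists_lipschitzOnWith_closedBall {V : F → F} (hV : LocallyLipschitz V)
    {K : Set F} (hK : IsCompact K) : ∃ δ : ℝ, 0 < δ ∧ ∃ L M : NNReal, ∀ x ∈ K,
      LipschitzOnWith L V (Metric.closedBall x δ) ∧ ∀ y ∈ Metric.closedBall x δ, ‖V y‖ ≤ M := by
  refine hK.induction_on (p := fun K => ∃ δ : ℝ, 0 < δ ∧ ∃ L M : NNReal, ∀ x ∈ K,
      LipschitzOnWith L V (Metric.closedBall x δ) ∧ ∀ y ∈ Metric.closedBall x δ, ‖V y‖ ≤ M)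
    ?_ ?_ ?_ ?_
  · exact ⟨1, one_pos, 0, 0, fun x hx => absurd hx (Set.notMem_empty x)⟩
  · rintro s t hst ⟨δ, hδ, L, M, h⟩
    exact ⟨δ, hδ, L, M, fun x hx => h x (hst hx)⟩
  · rintro s t ⟨δ, hδ, L, M, h⟩ ⟨δ', hδ', L', M', h'⟩
    refine ⟨min δ δ', lt_min hδ hδ', max L L', max M M', ?_⟩
    have hs : ∀ x : F, Metric.closedBall x (min δ δ') ⊆ Metric.closedBall x δ := fun x =>
      Metric.closedBall_subset_closedBall (min_le_left _ _)
    have hs' : ∀ x : F, Metric.closedBall x (min δ δ') ⊆ Metric.closedBall x δ' := fun x =>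
      Metric.closedBall_subset_closedBall (min_le_right _ _)
    rintro x (hx | hx)
    · exact ⟨((h x hx).1.mono (hs x)).weaken (le_max_left _ _), fun y hy =>
        ((h x hx).2 y (hs x hy)).trans (NNReal.coe_le_coe.2 (le_max_left _ _))⟩
    · exact ⟨((h' x hx).1.mono (hs' x)).weaken (le_max_right _ _), fun y hy =>
        ((h' x hx).2 y (hs' x hy)).trans (NNReal.coe_le_coe.2 (le_max_right _ _))⟩
  · intro x _
    obtain ⟨L, t, ht, hL⟩ := hV x
    obtain ⟨δ, hδ, hδt⟩ := Metric.mem_nhds_iff.1 ht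
    refine ⟨Metric.ball x (δ / 2), mem_nhdsWithin_of_mem_nhds (Metric.ball_mem_nhds x (by
      positivity)), δ / 4, by positivity, L, ‖V x‖₊ + L * δ.toNNReal, fun y hy => ?_⟩
    have hsub : Metric.closedBall y (δ / 4) ⊆ Metric.ball x δ := by
      intro z hz
      rw [Metric.mem_closedBall] at hz
      rw [Metric.mem_ball] at hy ⊢
      linarith [dist_triangle z y x]
    refine ⟨hL.mono (hsub.trans hδt), fun z hz => ?_⟩
    have h1 := hL.dist_le_mul z (hδt (hsub hz)) x (hδt (Metric.mem_ball_self hδ))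
    have h2 : dist z x ≤ δ := (Metric.mem_ball.1 (hsub hz)).le
    rw [dist_eq_norm] at h1
    have h3 := norm_le_norm_add_norm_sub' (V z) (V x)
    push_cast
    rw [Real.coe_toNNReal δ hδ.le]
    calc ‖V z‖ ≤ ‖V x‖ + ‖V z - V x‖ := h3
      _ ≤ ‖V x‖ + L * δ := by gcongr; exact h1.trans (by gcongr)

variable [NormedSpace ℝ F]

/-- An integral curve stays close to its tangent as long as the field is controlled. -/
theorem IsIntegralCurveOn.norm_sub_le {V : F → F} {γ : ℝ → F} {t ρ : ℝ} {L M : NNReal}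
    (hγ : IsIntegralCurveOn γ (fun _ x => V x) (Set.uIcc 0 t))
    (hL : LipschitzOnWith L V (Metric.closedBall (γ 0) ρ))
    (hM : ∀ y ∈ Metric.closedBall (γ 0) ρ, ‖V y‖ ≤ M) (ht : |t| * M < ρ) :
    ‖γ t - γ 0 - t • V (γ 0)‖ ≤ L * M * t ^ 2 := by
  set w := γ 0 with hw
  -- Rescaling time to `[0, 1]` treats both signs of `t` together.
  set g : ℝ → F := fun s => γ (s * t) with hg
  have hmaps : Set.MapsTo (fun s : ℝ => s * t) (Set.Icc 0 1) (Set.uIcc 0 t) := by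
    intro s hs
    rw [← segment_eq_uIcc]
    exact ⟨1 - s, s, by linarith [hs.2], hs.1, by ring, by simp⟩
  have hd : ∀ s ∈ Set.Icc (0 : ℝ) 1, HasDerivWithinAt g (t • V (g s)) (Set.Icc 0 1) s := by
    intro s hs
    have h1 : HasDerivWithinAt (fun s : ℝ => s * t) t (Set.Icc 0 1) s := by
      simpa using ((hasDerivAt_id s).mul_const t).hasDerivWithinAt
    exact HasDerivWithinAt.scomp s (hγ _ (hmaps hs)) h1 hmaps
  have hcont : ContinuousOn g (Set.Icc 0 1) := fun s hs => (hd s hs).continuousWithinAt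
  have hg0 : g 0 = w := by simp [hg, hw]
  have hρ : 0 ≤ ρ := le_trans (by positivity) ht.le
  have hright : ∀ s ∈ Set.Ico (0 : ℝ) 1, HasDerivWithinAt g (t • V (g s)) (Set.Ici s) s := fun s hs =>
    (hd s ⟨hs.1, hs.2.le⟩).mono_of_mem_nhdsWithin
      (mem_of_superset (Icc_mem_nhdsGE hs.2) (Set.Icc_subset_Icc_left hs.1))
  -- Barrier argument: inside the ball the speed is at most `|t| M < ρ`, so the distance to `w`
  -- cannot cross `ρ * s`.
  have hball : ∀ s ∈ Set.Icc (0 : ℝ) 1, ‖g s - w‖ ≤ ρ * s := by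
    intro s hs
    refine image_norm_le_of_norm_deriv_right_lt_deriv_boundary' (f := fun s => g s - w)
      (f' := fun s => t • V (g s)) (B := fun s => ρ * s) (B' := fun _ => ρ)
      (hcont.sub continuousOn_const) (fun s hs => (hright s hs).sub_const w) (by simp [hg0])
      (by fun_prop) (fun s _ => by simpa using ((hasDerivAt_id s).const_mul ρ).hasDerivWithinAt)
      (fun s hs heq => ?_) hs
    have hmem : g s ∈ Metric.closedBall w ρ := by
      rw [mem_closedBall_iff_norm, heq]
      nlinarith [hs.2]
    rw [norm_smul, Real.norm_eq_abs]
    exact (mul_le_mul_of_nonneg_left (hM _ hmem) (abs_nonneg t)).trans_lt ht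
  have hmem : ∀ s ∈ Set.Icc (0 : ℝ) 1, g s ∈ Metric.closedBall w ρ := fun s hs => by
    rw [mem_closedBall_iff_norm]
    exact (hball s hs).trans (by nlinarith [hs.2])
  have h1 : ∀ s ∈ Set.Icc (0 : ℝ) 1, ‖g s - w‖ ≤ |t| * M := by
    intro s hs
    have := norm_image_sub_le_of_norm_deriv_le_segment' hd (C := |t| * M) (fun r hr => by
      rw [norm_smul, Real.norm_eq_abs]
      exact mul_le_mul_of_nonneg_left (hM _ (hmem r ⟨hr.1, hr.2.le⟩)) (abs_nonneg t)) s hs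
    rw [hg0, sub_zero] at this
    exact this.trans (mul_le_of_le_one_right (by positivity) hs.2)
  have h2 : ∀ s ∈ Set.Icc (0 : ℝ) 1, HasDerivWithinAt (fun s => g s - s • t • V w)
      (t • V (g s) - t • V w) (Set.Icc 0 1) s := fun s hs => by
    refine (hd s hs).sub ?_
    simpa using ((hasDerivAt_id s).smul_const (t • V w)).hasDerivWithinAt
  have h3 := norm_image_sub_le_of_norm_deriv_le_segment_01' h2 (C := L * M * t ^ 2) (fun s hs => by
    have hs' : s ∈ Set.Icc (0 : ℝ) 1 := ⟨hs.1, hs.2.le⟩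
    have hl := hL.dist_le_mul _ (hmem s hs') w (Metric.mem_closedBall_self hρ)
    rw [dist_eq_norm, dist_eq_norm] at hl
    rw [← smul_sub, norm_smul, Real.norm_eq_abs]
    calc |t| * ‖V (g s) - V w‖ ≤ |t| * (L * (|t| * M)) := by
          gcongr
          exact hl.trans (by gcongr; exact h1 s hs')
      _ = L * M * t ^ 2 := by rw [← sq_abs t]; ring)
  simpa [hg0, hg, sub_right_comm] using h3

theorem exists_isIntegralCurveOn [CompleteSpace F] {V : F → F} {w : F} {t : ℝ} {ρ L M : NNReal}
    (hL : LipschitzOnWith L V (Metric.closedBall w ρ))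
    (hM : ∀ y ∈ Metric.closedBall w ρ, ‖V y‖ ≤ M) (ht : |t| * M ≤ ρ) :
    ∃ γ : ℝ → F, γ 0 = w ∧ IsIntegralCurveOn γ (fun _ x => V x) (Set.uIcc 0 t) := by
  -- Only the initial point `w` matters, so `r = 0` and the full radius `ρ` is available for the
  -- motion.
  have h := IsPicardLindelof.of_time_independent (t₀ := (⟨0, Set.left_mem_uIcc⟩ : Set.Icc (min 0 t)
    (max 0 t))) (r := 0) hM hL (by
      simp only [NNReal.coe_zero, sub_zero]
      refine le_trans ?_ ht
      rw [mul_comm]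
      gcongr
      rcases le_total 0 t with h | h
      · simp [h, abs_of_nonneg h]
      · simp [h, abs_of_nonpos h])
  exact h.exists_eq_forall_mem_Icc_hasDerivWithinAt₀

end LocallyLipschitz

/-! ### The Duhamel equation and the two nonlinear flows. -/

section Duhamel

variable {H : Type*} [NormedAddCommGroup H] [InnerProductSpace ℂ H]
  {U : ℝ → H →L[ℂ] H} {B : H → H} {u₀ : H} {T : ℝ} {u v : ℝ → H}

theorem IsDuhamelSolution.mono (h : IsDuhamelSolution U B u₀ T u) {T' : ℝ} (hT : T' ≤ T) :
    IsDuhamelSolution U B u₀ T' u :=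
  ⟨h.1.mono (Set.Icc_subset_Icc_right hT), fun t ht => h.2 t (Set.Icc_subset_Icc_right hT ht)⟩

theorem exists_isDuhamelSolution_of_lt_maximalTime (h : (T : EReal) < maximalTime U B u₀) :
    ∃ u, IsDuhamelSolution U B u₀ T u := by
  obtain ⟨_, ⟨T', -, rfl, u, hu⟩, hlt⟩ := lt_sSup_iff.1 h
  exact ⟨u, hu.mono (EReal.coe_lt_coe_iff.1 hlt).le⟩

variable [CompleteSpace H] {A : H →ₗ.[ℂ] H}

theorem IsDuhamelSolution.continuousOn_integrand (hU : IsUnitaryGroupGeneratedBy A U)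
    (hB : Continuous B) (h : IsDuhamelSolution U B u₀ T u) :
    ContinuousOn (fun s => U (-s) (-(Complex.I • B (u s)))) (Set.Icc 0 T) := by
  have h1 : ContinuousOn (fun s => (-s, -(Complex.I • B (u s)))) (Set.Icc 0 T) :=
    continuousOn_id.neg.prodMk ((hB.comp_continuousOn h.1).const_smul Complex.I).neg
  exact hU.continuous_apply.comp_continuousOn h1

/-- Interaction picture: for `U(-t)u(t)` the unbounded generator disappears and the integrand no
longer depends on the upper limit. -/
theorem IsDuhamelSolution.apply_neg_eq (hU : IsUnitaryGroupGeneratedBy A U)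
    (hB : Continuous B) (h : IsDuhamelSolution U B u₀ T u) {t : ℝ} (ht : t ∈ Set.Icc 0 T) :
    U (-t) (u t) = u₀ + ∫ s in (0 : ℝ)..t, U (-s) (-(Complex.I • B (u s))) := by
  have hi : IntervalIntegrable (fun s => U (t - s) (B (u s))) volume 0 t := by
    refine ContinuousOn.intervalIntegrable ?_
    rw [Set.uIcc_of_le ht.1]
    have h1 : ContinuousOn (fun s => (t - s, B (u s))) (Set.Icc 0 t) :=
      (continuousOn_const.sub continuousOn_id).prodMk
        (hB.comp_continuousOn (h.1.mono (Set.Icc_subset_Icc_right ht.2)))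
    exact hU.continuous_apply.comp_continuousOn h1
  rw [h.2 t ht, map_sub, hU.apply_apply, neg_add_cancel, hU.zero_apply, map_smul,
    ← ContinuousLinearMap.intervalIntegral_comp_comm _ hi, sub_eq_add_neg,
    ← intervalIntegral.integral_smul, ← intervalIntegral.integral_neg]
  congr 1
  refine intervalIntegral.integral_congr fun s _ => ?_
  simp only [hU.apply_apply, map_neg, map_smul]
  rw [show -t + (t - s) = -s by ring]

/-- Duhamel's formula between two times. -/
theorem IsDuhamelSolution.eq_add_integral (hU : IsUnitaryGroupGeneratedBy A U)
    (hB : Continuous B) (h : IsDuhamelSolution U B u₀ T u) {s t : ℝ} (hs : s ∈ Set.Icc 0 T)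
    (ht : t ∈ Set.Icc 0 T) :
    u t = U (t - s) (u s) + ∫ r in s..t, U (t - r) (-(Complex.I • B (u r))) := by
  have hc := h.continuousOn_integrand hU hB
  have hi : ∀ {a b}, a ∈ Set.Icc 0 T → b ∈ Set.Icc 0 T →
      IntervalIntegrable (fun s => U (-s) (-(Complex.I • B (u s)))) volume a b := fun ha hb =>
    (hc.mono (Set.ordConnected_Icc.uIcc_subset ha hb)).intervalIntegrable
  have h0 : (0 : ℝ) ∈ Set.Icc 0 T := ⟨le_rfl, hs.1.trans hs.2⟩
  have h1 : U (-t) (u t) = U (-s) (u s) + ∫ r in s..t, U (-r) (-(Complex.I • B (u r))) := by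
    rw [h.apply_neg_eq hU hB hs, h.apply_neg_eq hU hB ht, add_assoc,
      intervalIntegral.integral_add_adjacent_intervals (hi h0 hs) (hi hs ht)]
  have h2 := congrArg (U t) h1
  rw [hU.apply_apply, add_neg_cancel, hU.zero_apply, map_add, hU.apply_apply,
    ← ContinuousLinearMap.intervalIntegral_comp_comm _ (hi hs ht)] at h2
  simpa only [hU.apply_apply, ← sub_eq_add_neg] using h2

theorem IsDuhamelSolution.hasDerivWithinAt (hU : IsUnitaryGroupGeneratedBy A U)
    (hB : Continuous B) (h : IsDuhamelSolution U B u₀ T u) {t : ℝ} (ht : t ∈ Set.Ico 0 T) :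
    HasDerivWithinAt (fun s => U (-s) (u s)) (U (-t) (-(Complex.I • B (u t)))) (Set.Ici t) t := by
  have hT : (0 : ℝ) ≤ T := ht.1.trans ht.2.le
  set g := fun s => U (-s) (-(Complex.I • B (u s)))
  have hc : ContinuousOn g (Set.Icc 0 T) := h.continuousOn_integrand hU hB
  -- A continuous extension of the integrand to the whole line, so that the fundamental theorem of
  -- calculus applies also at the endpoint `0`.
  set G := Set.IccExtend hT ((Set.Icc 0 T).domRestrict g)
  have hG : Continuous G := hc.domRestrict.Icc_extend'
  have hGg : ∀ s ∈ Set.Icc 0 T, G s = g s := fun s hs => by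
    exact Set.IccExtend_of_mem hT _ hs
  have h1 : HasDerivAt (fun s => u₀ + ∫ r in (0 : ℝ)..s, G r) (G t) t :=
    (hG.integral_hasStrictDerivAt 0 t).hasDerivAt.const_add u₀
  have ht' : t ∈ Set.Icc 0 T := ⟨ht.1, ht.2.le⟩
  have h2 : ∀ s ∈ Set.Icc 0 T, U (-s) (u s) = u₀ + ∫ r in (0 : ℝ)..s, G r := fun s hs => by
    rw [h.apply_neg_eq hU hB hs]
    congr 1
    refine intervalIntegral.integral_congr fun r hr => (hGg r ?_).symm
    rw [Set.uIcc_of_le hs.1] at hr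
    exact Set.Icc_subset_Icc_right hs.2 hr
  rw [hGg t ht'] at h1
  refine h1.hasDerivWithinAt.congr_of_eventuallyEq ?_ (h2 t ht')
  filter_upwards [Icc_mem_nhdsGE ht.2] with s hs
  exact h2 s ⟨ht.1.trans hs.1, hs.2⟩

/-- Solutions of the Duhamel equation are unique. -/
theorem IsDuhamelSolution.eqOn (hU : IsUnitaryGroupGeneratedBy A U) (hB : LocallyLipschitz B)
    (hu : IsDuhamelSolution U B u₀ T u) (hv : IsDuhamelSolution U B u₀ T v) :
    Set.EqOn u v (Set.Icc 0 T) := by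
  have hBc := hB.continuous
  have hK := (isCompact_Icc.image_of_continuousOn hu.1).union
    (isCompact_Icc.image_of_continuousOn hv.1)
  set K := u '' Set.Icc 0 T ∪ v '' Set.Icc 0 T
  obtain ⟨L, hL⟩ := hB.locallyLipschitzOn.exists_lipschitzOnWith_of_compact hK
  have hcont : ∀ {u}, IsDuhamelSolution U B u₀ T u →
      ContinuousOn (fun s => U (-s) (u s)) (Set.Icc 0 T) := fun h =>
    hU.continuous_apply.comp_continuousOn (continuousOn_id.neg.prodMk h.1)
  have hUU : ∀ t x, U t (U (-t) x) = x := fun t x => by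
    rw [hU.apply_apply, add_neg_cancel, hU.zero_apply]
  rcases lt_or_ge T 0 with hT | hT
  · simp [Set.Icc_eq_empty (not_le.2 hT)]
  -- Uniqueness for the interaction-picture field. `B` is Lipschitz on the compact union `K` of both
  -- trajectories, and the isometries `U(t)` preserve the constant.
  have key := ODE_solution_unique_of_mem_Icc_right (K := L) (a := 0) (b := T)
    (v := fun t x => U (-t) (-(Complex.I • B (U t x)))) (s := fun t => {x | U t x ∈ K})
    (f := fun t => U (-t) (u t)) (g := fun t => U (-t) (v t)) ?_ (hcont hu)
    (fun t ht => by simpa only [hUU] using hu.hasDerivWithinAt hU hBc ht) ?_ (hcont hv)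
    (fun t ht => by simpa only [hUU] using hv.hasDerivWithinAt hU hBc ht) ?_ ?_
  · intro t ht
    have h1 := congrArg (U t) (key ht)
    simpa only [hUU] using h1
  · intro t _
    refine LipschitzOnWith.of_dist_le_mul fun x hx y hy => ?_
    have h1 := hL.dist_le_mul _ hx _ hy
    rw [dist_eq_norm, dist_eq_norm, ← map_sub, hU.norm_apply] at h1
    rw [dist_eq_norm, ← map_sub, hU.norm_apply, neg_sub_neg, ← smul_sub, norm_smul,
      Complex.norm_I, one_mul, dist_eq_norm, norm_sub_rev]
    exact h1
  · intro t ht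
    simp only [Set.mem_ofPred_eq, hUU]
    exact Or.inl ⟨t, ⟨ht.1, ht.2.le⟩, rfl⟩
  · intro t ht
    simp only [Set.mem_ofPred_eq, hUU]
    exact Or.inr ⟨t, ⟨ht.1, ht.2.le⟩, rfl⟩
  · have h0 : (0 : ℝ) ∈ Set.Icc 0 T := ⟨le_rfl, hT⟩
    rw [hu.apply_neg_eq hU hBc h0, hv.apply_neg_eq hU hBc h0]
    simp

theorem IsDuhamelSolution.mem_exactFlow (hU : IsUnitaryGroupGeneratedBy A U)
    (hB : LocallyLipschitz B) (hu : IsDuhamelSolution U B u₀ T u) {t : ℝ} (ht : t ∈ Set.Icc 0 T) :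
    u t ∈ exactFlow U B t u₀ := by
  have h : 0 ≤ t ∧ ∃ u, IsDuhamelSolution U B u₀ t u := ⟨ht.1, u, hu.mono ht.2⟩
  exact ⟨h, h.2.choose_spec.eqOn hU hB (hu.mono ht.2) ⟨ht.1, le_rfl⟩⟩

/-- The flow value belongs to an unspecified chosen curve; the estimate holds for every integral
curve, so uniqueness is not needed. -/
theorem exists_mem_nonlinearFlow {w : H} {t ρ : ℝ} {L M : NNReal}
    (hL : LipschitzOnWith L (fun x => -(Complex.I • B x)) (Metric.closedBall w ρ))
    (hM : ∀ y ∈ Metric.closedBall w ρ, ‖-(Complex.I • B y)‖ ≤ M) (ht : |t| * M < ρ) :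
    ∃ y ∈ nonlinearFlow B t w, ‖y - w - t • -(Complex.I • B w)‖ ≤ L * M * t ^ 2 := by
  lift ρ to NNReal using le_trans (by positivity) ht.le
  have hex := exists_isIntegralCurveOn hL hM ht.le
  refine ⟨hex.choose t, ⟨hex, rfl⟩, ?_⟩
  obtain ⟨h0, hγ⟩ := hex.choose_spec
  have h := hγ.norm_sub_le (by rwa [h0]) (by rwa [h0]) ht
  rwa [h0] at h

end Duhamel

/-! ### Error recursion of the splitting scheme. -/

/-- The error bound of a splitting scheme after `p` substeps, with gain `G`, step size `h` and
consistency error `η`. -/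
noncomputable def splittingError (G h η : ℝ) : ℕ → ℝ
  | 0 => η
  | p + 1 => (1 + G * h) * splittingError G h η p + G * h * (η + h)

section splittingError

variable {G h η : ℝ}

theorem splittingError_nonneg (hG : 0 ≤ G) (hh : 0 ≤ h) (hη : 0 ≤ η) (p : ℕ) :
    0 ≤ splittingError G h η p := by
  induction p with
  | zero => exact hη
  | succ p ih => rw [splittingError]; positivity

/-- Discrete Grönwall inequality: for `h * p` bounded the error stays comparable with `η + h`,
whatever the number of substeps. -/
theorem splittingError_le_exp (hG : 0 ≤ G) (hh : 0 ≤ h) (hη : 0 ≤ η) (p : ℕ) :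
    splittingError G h η p ≤ Real.exp (G * h * p) * (η + G * h * p * (η + h)) := by
  induction p with
  | zero => simp [splittingError]
  | succ p ih =>
    rw [splittingError]
    push_cast
    have h1 : 1 + G * h ≤ Real.exp (G * h) := by linarith [Real.add_one_le_exp (G * h)]
    have h2 : 1 ≤ Real.exp (G * h * (p + 1)) := Real.one_le_exp (by positivity)
    have h3 : Real.exp (G * h * (p + 1)) = Real.exp (G * h) * Real.exp (G * h * p) := by
      rw [← Real.exp_add]; ring_nf
    calc (1 + G * h) * splittingError G h η p + G * h * (η + h)
        ≤ Real.exp (G * h) * (Real.exp (G * h * p) * (η + G * h * p * (η + h))) +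
          Real.exp (G * h * (p + 1)) * (G * h * (η + h)) :=
        add_le_add (mul_le_mul h1 ih (splittingError_nonneg hG hh hη p) (Real.exp_pos _).le)
          (le_mul_of_one_le_left (by positivity) h2)
      _ = _ := by rw [h3]; ring

theorem splittingError_le (hG : 0 ≤ G) (hh : 0 ≤ h) (hη : 0 ≤ η) {p : ℕ} {T : ℝ}
    (hp : h * p ≤ T) :
    splittingError G h η p ≤ Real.exp (G * T) * (1 + G * T) * (η + h) := by
  have hT : 0 ≤ T := le_trans (by positivity) hp
  have h1 : G * h * p ≤ G * T := by rw [mul_assoc]; gcongr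
  calc splittingError G h η p ≤ Real.exp (G * h * p) * (η + G * h * p * (η + h)) :=
        splittingError_le_exp hG hh hη p
    _ ≤ Real.exp (G * T) * (η + G * T * (η + h)) := by gcongr
    _ ≤ Real.exp (G * T) * ((η + h) + G * T * (η + h)) := by gcongr; linarith
    _ = _ := by ring

end splittingError

/-- Consistency bounds of a splitting scheme along a trajectory `u`, for the seminorm `‖J ·‖`. -/
structure SplittingBounds {H X : Type*} [NormedAddCommGroup H] [InnerProductSpace ℂ H]
    [NormedAddCommGroup X] [InnerProductSpace ℂ X] (J : H →L[ℂ] X) (U : ℝ → H →L[ℂ] H)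
    (Q : H →L[ℂ] H) (V : H → H) (u : ℝ → H) (T h S δ η Λ N c : ℝ) : Prop where
  nonneg : 0 ≤ η
  norm_le : ∀ y, ‖J y‖ ≤ c * ‖y‖
  norm_apply : ∀ t y, ‖J (U t y)‖ = ‖J y‖
  norm_trunc : ∀ y, ‖J (Q y)‖ ≤ ‖J y‖
  trunc_sub : ∀ t ∈ Set.Icc 0 T, ‖J (Q (u t) - u t)‖ ≤ η
  traj : ∀ t ∈ Set.Icc 0 T, ∀ τ, |τ| ≤ S * h → ‖J (U τ (Q (u t)) - u t)‖ ≤ η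
  field : ∀ t ∈ Set.Icc 0 T, ∀ τ, |τ| ≤ S * h → ‖J (U τ (Q (V (u t))) - V (u t))‖ ≤ η
  lip : ∀ t ∈ Set.Icc 0 T, ∀ w, ‖w - u t‖ ≤ δ → ‖J (V w - V (u t))‖ ≤ Λ * ‖J (w - u t)‖
  bound : ∀ t ∈ Set.Icc 0 T, ‖J (V (u t))‖ ≤ N
  step : ∀ t ∈ Set.Icc 0 T, t + h ∈ Set.Icc 0 T →
    ‖J (Q (u (t + h)) - (U h (Q (u t)) + h • V (u t)))‖ ≤ h * η

namespace SplittingBounds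

variable {H X : Type*} [NormedAddCommGroup H] [InnerProductSpace ℂ H]
  [NormedAddCommGroup X] [InnerProductSpace ℂ X] {J : H →L[ℂ] X} {U : ℝ → H →L[ℂ] H}
  {Q : H →L[ℂ] H} {V : H → H} {u : ℝ → H} {T h S δ η Λ N c : ℝ}

section Substep

variable {t τ σ β b D : ℝ} {y : H}

/-- The linear part of a substep. -/
theorem norm_linear_le (hb : SplittingBounds J U Q V u T h S δ η Λ N c)
    (hUU : ∀ s t x, U s (U t x) = U (s + t) x) (hQQ : ∀ x, Q (Q x) = Q x)
    (hUQ : ∀ t x, U t (Q x) = Q (U t x)) (ht : t ∈ Set.Icc 0 T) (hσ : |σ| ≤ S * h)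
    (hβ : |β| ≤ S * h) (hD : ‖J (y - (U τ (Q (u t)) + β • V (u t)))‖ ≤ D) :
    ‖J (U σ (Q y) - (U (τ + σ) (Q (u t)) + β • V (u t)))‖ ≤ D + S * h * η := by
  -- The old error passes through a contraction and the truncated orbit is transported exactly; only
  -- the term with the small factor `β` leaves a defect.
  have h1 : U σ (Q y) - (U (τ + σ) (Q (u t)) + β • V (u t)) =
      U σ (Q (y - (U τ (Q (u t)) + β • V (u t)))) + β • (U σ (Q (V (u t))) - V (u t)) := by
    have h2 : ∀ (L : H →L[ℂ] H) (r : ℝ) (x : H), L (r • x) = r • L x := fun L r x => by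
      rw [← Complex.coe_smul, map_smul, Complex.coe_smul]
    simp only [map_sub, map_add, h2, smul_sub]
    rw [hUQ τ, hQQ, ← hUQ τ, hUU σ τ, add_comm σ τ]
    abel
  have h3 : J (β • (U σ (Q (V (u t))) - V (u t))) = β • J (U σ (Q (V (u t))) - V (u t)) := by
    rw [← Complex.coe_smul, map_smul, Complex.coe_smul]
  rw [h1, map_add, h3]
  refine (norm_add_le _ _).trans (add_le_add ?_ ?_)
  · rw [hb.norm_apply]
    exact (hb.norm_trunc _).trans hD
  · rw [norm_smul, Real.norm_eq_abs]
    exact mul_le_mul hβ (hb.field t ht σ hσ) (norm_nonneg _) ((abs_nonneg _).trans hβ)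

theorem norm_sub_traj_le (hb : SplittingBounds J U Q V u T h S δ η Λ N c) {w : H}
    (ht : t ∈ Set.Icc 0 T) (hτ : |τ| ≤ S * h) (hβ : |β| ≤ S * h)
    (hD : ‖J (w - (U τ (Q (u t)) + β • V (u t)))‖ ≤ D) :
    ‖J (w - u t)‖ ≤ D + S * h * N + η := by
  have h1 : w - u t = (w - (U τ (Q (u t)) + β • V (u t))) + β • V (u t) +
      (U τ (Q (u t)) - u t) := by abel
  have h3 : J (β • V (u t)) = β • J (V (u t)) := by
    rw [← Complex.coe_smul, map_smul, Complex.coe_smul]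
  rw [h1, map_add, map_add, h3]
  refine (norm_add₃_le).trans (add_le_add (add_le_add hD ?_) (hb.traj t ht τ hτ))
  rw [norm_smul, Real.norm_eq_abs]
  exact mul_le_mul hβ (hb.bound t ht) (norm_nonneg _) ((abs_nonneg _).trans hβ)

/-- The error recursion for one substep. -/
theorem norm_substep_le (hb : SplittingBounds J U Q V u T h S δ η Λ N c) {w y' : H} {M G : ℝ}
    (ht : t ∈ Set.Icc 0 T) (hτ : |τ| ≤ S * h) (hβ : |β| ≤ S * h) (hbS : |b| ≤ S * h)
    (hh : 0 ≤ h) (hh1 : h ≤ 1) (hS : 0 ≤ S) (hΛ : 0 ≤ Λ) (hN : 0 ≤ N) (hM : 0 ≤ M) (hc : 0 ≤ c)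
    (hG : S + S * Λ * (S + 1) + S * S * Λ * N + c * M * S ^ 2 ≤ G) (hD0 : 0 ≤ D)
    (hD : ‖J (w - (U τ (Q (u t)) + β • V (u t)))‖ ≤ D + S * h * η)
    (hw : ‖w - u t‖ ≤ δ) (hy' : ‖y' - w - b • V w‖ ≤ M * b ^ 2) :
    ‖J (y' - (U τ (Q (u t)) + (β + b) • V (u t)))‖ ≤ (1 + G * h) * D + G * h * (η + h) := by
  have hη := hb.nonneg
  -- Three sources: the inherited error, the second-order remainder of the flow, and the field
  -- evaluated at `w` instead of on the trajectory.
  have h1 : y' - (U τ (Q (u t)) + (β + b) • V (u t)) = (w - (U τ (Q (u t)) + β • V (u t))) +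
      (y' - w - b • V w) + b • (V w - V (u t)) := by
    rw [add_smul, smul_sub]; abel
  have h3 : J (b • (V w - V (u t))) = b • J (V w - V (u t)) := by
    rw [← Complex.coe_smul, map_smul, Complex.coe_smul]
  have h4 : ‖J (y' - w - b • V w)‖ ≤ c * (M * (S * h) ^ 2) := by
    refine (hb.norm_le _).trans (mul_le_mul_of_nonneg_left (hy'.trans ?_) hc)
    rw [← sq_abs b]
    gcongr
  have h5 : ‖b • J (V w - V (u t))‖ ≤ S * h * (Λ * (D + S * h * η + S * h * N + η)) := by
    rw [norm_smul, Real.norm_eq_abs]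
    gcongr
    exact (hb.lip t ht w hw).trans (by gcongr; exact hb.norm_sub_traj_le ht hτ hβ hD)
  rw [h1, map_add, map_add, h3]
  refine (norm_add₃_le).trans ((add_le_add (add_le_add hD h4) h5).trans ?_)
  have e1 : 0 ≤ S * Λ := by positivity
  have e2 : 0 ≤ S * S * Λ * N := by positivity
  have e3 : 0 ≤ c * M * S ^ 2 := by positivity
  have e4 : 0 ≤ S * Λ * S := by positivity
  -- `G` dominates the coefficients of `h * D`, `h * η` and `h * h`; one further term of order `h² *
  -- η` is absorbed by `h ≤ 1`.
  have g1 : S * Λ ≤ G := by nlinarith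
  have g2 : S + S * Λ * (S + 1) ≤ G := by nlinarith
  have g3 : S * S * Λ * N + c * M * S ^ 2 ≤ G := by nlinarith
  have k1 : S * Λ * (h * D) ≤ G * (h * D) := by gcongr
  have k2 : (S + S * Λ * (S + 1)) * (h * η) ≤ G * (h * η) := by gcongr
  have k3 : (S * S * Λ * N + c * M * S ^ 2) * (h * h) ≤ G * (h * h) := by gcongr
  have k4 : S * Λ * S * (h * η) * h ≤ S * Λ * S * (h * η) * 1 := by gcongr
  nlinarith

end Substep

end SplittingBounds

/-- Data of a splitting scheme near a trajectory, controlled in the norm of the space itself and in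
the weaker seminorm `‖ι ·‖`. -/
structure SplittingControl {H X : Type*} [NormedAddCommGroup H] [InnerProductSpace ℂ H]
    [NormedAddCommGroup X] [InnerProductSpace ℂ X] (ι : H →L[ℂ] X) (U : ℝ → H →L[ℂ] H)
    (Q : H →L[ℂ] H) (V : H → H) (u : ℝ → H) (ΨA ΦB : ℝ → H → Part H)
    (T h S δ η₁ η₀ Λ N c M G : ℝ) : Prop where
  strong : SplittingBounds (ContinuousLinearMap.id ℂ H) U Q V u T h S δ η₁ Λ N c
  weak : SplittingBounds ι U Q V u T h S δ η₀ Λ N c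
  zero_apply : ∀ x, U 0 x = x
  apply_apply : ∀ s t x, U s (U t x) = U (s + t) x
  trunc_trunc : ∀ x, Q (Q x) = Q x
  apply_trunc : ∀ t x, U t (Q x) = Q (U t x)
  mem_linear : ∀ s y, U s (Q y) ∈ ΨA s y
  exists_mem_flow : ∀ t ∈ Set.Icc 0 T, ∀ w, ‖w - u t‖ ≤ δ → ∀ b, |b| ≤ S * h →
    ∃ y ∈ ΦB b w, ‖y - w - b • V w‖ ≤ M * b ^ 2
  h_nonneg : 0 ≤ h
  h_le_one : h ≤ 1
  S_nonneg : 0 ≤ S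
  Λ_nonneg : 0 ≤ Λ
  N_nonneg : 0 ≤ N
  M_nonneg : 0 ≤ M
  c_nonneg : 0 ≤ c
  le_gain : S + S * Λ * (S + 1) + S * S * Λ * N + c * M * S ^ 2 ≤ G
  one_le_gain : 1 ≤ G

namespace SplittingControl

variable {H X : Type*} [NormedAddCommGroup H] [InnerProductSpace ℂ H]
  [NormedAddCommGroup X] [InnerProductSpace ℂ X] {ι : H →L[ℂ] X} {U : ℝ → H →L[ℂ] H}
  {Q : H →L[ℂ] H} {V : H → H} {u : ℝ → H} {ΨA ΦB : ℝ → H → Part H}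
  {T h S δ η₁ η₀ Λ N c M G : ℝ}

/-- `α` and `β` accumulate the coefficients already used. The sums of absolute values keep all
partial sums within `S`, even for negative coefficients; the strong estimate keeps `w` in the tube
where the flow exists. -/
theorem exists_mem_foldl (hc : SplittingControl ι U Q V u ΨA ΦB T h S δ η₁ η₀ Λ N c M G)
    {κ : Type*} (a b : κ → ℝ) {t : ℝ} (ht : t ∈ Set.Icc 0 T) {P : ℕ}
    (hsmall : ∀ p < P, splittingError G h η₁ p + S * h * η₁ + S * h * N + η₁ ≤ δ)
    (l : List κ) : ∀ (y : H) (α β : ℝ) (p : ℕ), |α| + (l.map fun j => |a j|).sum ≤ S →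
      |β| + (l.map fun j => |b j|).sum ≤ S → p + l.length ≤ P →
      ‖y - (U (α * h) (Q (u t)) + (β * h) • V (u t))‖ ≤ splittingError G h η₁ p →
      ‖ι (y - (U (α * h) (Q (u t)) + (β * h) • V (u t)))‖ ≤ splittingError G h η₀ p →
      ∃ y' ∈ l.foldl (fun y j => (y.bind (ΨA (a j * h))).bind (ΦB (b j * h))) (Part.some y),
        ‖y' - (U ((α + (l.map a).sum) * h) (Q (u t)) + ((β + (l.map b).sum) * h) • V (u t))‖ ≤
          splittingError G h η₁ (p + l.length) ∧
        ‖ι (y' - (U ((α + (l.map a).sum) * h) (Q (u t)) +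
          ((β + (l.map b).sum) * h) • V (u t)))‖ ≤ splittingError G h η₀ (p + l.length) := by
  have hh := hc.h_nonneg
  have hG : 0 ≤ G := zero_le_one.trans hc.one_le_gain
  induction l with
  | nil =>
    intro y α β p _ _ _ h1 h0
    exact ⟨y, Part.mem_some y, by simpa using h1, by simpa using h0⟩
  | cons j l ih =>
    intro y α β p hα hβ hp h1 h0
    simp only [List.map_cons, List.sum_cons, List.length_cons] at hα hβ hp ⊢
    have hsa : 0 ≤ (l.map fun j => |a j|).sum := List.sum_nonneg (by simp)
    have hsb : 0 ≤ (l.map fun j => |b j|).sum := List.sum_nonneg (by simp)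
    have hmul : ∀ {r : ℝ}, |r| ≤ S → |r * h| ≤ S * h := fun hr => by
      rw [abs_mul, abs_of_nonneg hh]; gcongr
    have hσ : |a j * h| ≤ S * h := hmul (by linarith [abs_nonneg α])
    have hb : |b j * h| ≤ S * h := hmul (by linarith [abs_nonneg β])
    have hβ' : |β * h| ≤ S * h := hmul (by linarith [abs_nonneg (b j)])
    have hα' : |α + a j| + (l.map fun j => |a j|).sum ≤ S := by linarith [abs_add_le α (a j)]
    have hβ'' : |β + b j| + (l.map fun j => |b j|).sum ≤ S := by linarith [abs_add_le β (b j)]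
    have hτ : |α * h + a j * h| ≤ S * h := by
      rw [← add_mul]; exact hmul (by linarith)
    have hl1 := hc.strong.norm_linear_le hc.apply_apply hc.trunc_trunc hc.apply_trunc ht hσ hβ' h1
    have hl0 := hc.weak.norm_linear_le hc.apply_apply hc.trunc_trunc hc.apply_trunc ht hσ hβ' h0
    set w := U (a j * h) (Q y)
    have hw : ‖w - u t‖ ≤ δ := by
      have h2 := hc.strong.norm_sub_traj_le ht hτ hβ' hl1
      have h3 := hsmall p (by omega)
      rw [ContinuousLinearMap.id_apply] at h2
      linarith
    obtain ⟨y', hy', hy'e⟩ := hc.exists_mem_flow t ht w hw (b j * h) hb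
    have hD1 := splittingError_nonneg hG hh hc.strong.nonneg p
    have hD0 := splittingError_nonneg hG hh hc.weak.nonneg p
    have hn1 := hc.strong.norm_substep_le ht hτ hβ' hb hh hc.h_le_one hc.S_nonneg hc.Λ_nonneg
      hc.N_nonneg hc.M_nonneg hc.c_nonneg hc.le_gain hD1 hl1 hw hy'e
    have hn0 := hc.weak.norm_substep_le ht hτ hβ' hb hh hc.h_le_one hc.S_nonneg hc.Λ_nonneg
      hc.N_nonneg hc.M_nonneg hc.c_nonneg hc.le_gain hD0 hl0 hw hy'e
    rw [← add_mul, ← add_mul] at hn1 hn0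
    obtain ⟨y'', hy'', he1, he0⟩ := ih y' (α + a j) (β + b j) (p + 1) hα' hβ'' (by omega) hn1 hn0
    refine ⟨y'', ?_, ?_, ?_⟩
    · rw [List.foldl_cons]
      have hy1 : ((Part.some y).bind (ΨA (a j * h))).bind (ΦB (b j * h)) = Part.some y' := by
        rw [Part.bind_some, Part.eq_some_iff.2 (hc.mem_linear (a j * h) y), Part.bind_some,
          Part.eq_some_iff.2 hy']
      rwa [hy1]
    · rwa [add_assoc α, add_assoc β, add_assoc p, add_comm 1] at he1
    · rwa [add_assoc α, add_assoc β, add_assoc p, add_comm 1] at he0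

/-- A step costs `m + 1` units of the recursion: `m` substeps, which end near `U(h)Q u(t) + h
V(u(t))` because both coefficient sums are `1`, and one unit to replace this point by `Q u(t + h)`.
-/
theorem exists_mem_partialIterate
    (hc : SplittingControl ι U Q V u ΨA ΦB T h S δ η₁ η₀ Λ N c M G)
    {m : ℕ} {a b : Fin m → ℝ} (ha : ∑ j, a j = 1) (hb : ∑ j, b j = 1)
    (haS : ∑ j, |a j| ≤ S) (hbS : ∑ j, |b j| ≤ S) {n : ℕ} (hn : n * h ≤ T)
    (hsmall : ∀ p < n * (m + 1), splittingError G h η₁ p + S * h * η₁ + S * h * N + η₁ ≤ δ) :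
    ∀ k ≤ n, ∃ v ∈ partialIterate (splittingStep ΨA ΦB a b h) k (u 0),
      ‖v - Q (u (k * h))‖ ≤ splittingError G h η₁ (k * (m + 1)) ∧
      ‖ι (v - Q (u (k * h)))‖ ≤ splittingError G h η₀ (k * (m + 1)) := by
  have hh := hc.h_nonneg
  have hT : ∀ k ≤ n, (k : ℝ) * h ∈ Set.Icc 0 T := fun k hk =>
    ⟨by positivity, le_trans (by gcongr) hn⟩
  have hG : 0 ≤ G := zero_le_one.trans hc.one_le_gain
  intro k
  induction k with
  | zero =>
    intro hk
    have h0 := hT 0 hk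
    -- The scheme starts at the untruncated datum, so the initial error is `η`, not zero.
    refine ⟨u 0, Part.mem_some _, ?_, ?_⟩
    · have := hc.strong.trunc_sub _ h0
      rw [ContinuousLinearMap.id_apply, norm_sub_rev] at this
      simpa [splittingError] using this
    · have := hc.weak.trunc_sub _ h0
      rw [map_sub, norm_sub_rev, ← map_sub] at this
      simpa [splittingError] using this
  | succ k ih =>
    intro hk
    obtain ⟨v, hv, h1, h0⟩ := ih (by omega)
    have ht := hT k (by omega)
    have ht' := hT (k + 1) hk
    have hkm : k * (m + 1) + m < n * (m + 1) := by
      calc k * (m + 1) + m < (k + 1) * (m + 1) := by ring_nf; omega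
        _ ≤ n * (m + 1) := Nat.mul_le_mul_right _ hk
    obtain ⟨v', hv', he1, he0⟩ := hc.exists_mem_foldl a b ht (P := k * (m + 1) + m)
      (fun p hp => hsmall p (by omega)) (List.finRange m) v 0 0 (k * (m + 1))
      (by rw [abs_zero, zero_add, ← Fin.sum_univ_def]; exact haS)
      (by rw [abs_zero, zero_add, ← Fin.sum_univ_def]; exact hbS)
      (by simp) (by simpa [hc.zero_apply] using h1) (by simpa [hc.zero_apply] using h0)
    rw [← Fin.sum_univ_def, ← Fin.sum_univ_def, ha, hb, zero_add, one_mul, List.length_finRange]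
      at he1 he0
    have hkh : (k : ℝ) * h + h = ((k + 1 : ℕ) : ℝ) * h := by push_cast; ring
    have hs1 := hc.strong.step _ ht (hkh ▸ ht')
    have hs0 := hc.weak.step _ ht (hkh ▸ ht')
    rw [hkh] at hs1 hs0
    set z := U h (Q (u (k * h))) + h • V (u (k * h))
    have hfin : ∀ {η D : ℝ}, 0 ≤ η → 0 ≤ D → D + h * η ≤ (1 + G * h) * D + G * h * (η + h) := by
      intro η D hη hD
      have e1 : 0 ≤ G * h * D := by positivity
      have e2 : 1 * (h * η) ≤ G * (h * η) := by gcongr; exact hc.one_le_gain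
      have e3 : 0 ≤ G * h * h := by positivity
      nlinarith
    have hidx : (k + 1) * (m + 1) = k * (m + 1) + m + 1 := by ring
    have hsplit : v' - Q (u (((k + 1 : ℕ) : ℝ) * h)) =
        (v' - z) - (Q (u (((k + 1 : ℕ) : ℝ) * h)) - z) := by abel
    refine ⟨v', Part.mem_bind hv hv', ?_, ?_⟩
    · rw [hidx, splittingError, hsplit]
      exact (norm_sub_le _ _).trans ((add_le_add he1 hs1).trans
        (hfin hc.strong.nonneg (splittingError_nonneg hG hh hc.strong.nonneg _)))
    · rw [hidx, splittingError, hsplit, map_sub]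
      exact (norm_sub_le _ _).trans ((add_le_add he0 hs0).trans
        (hfin hc.weak.nonneg (splittingError_nonneg hG hh hc.weak.nonneg _)))

end SplittingControl

theorem tendsto_sq_inv_nhdsGT_zero : Tendsto (fun h : ℝ => (h ^ 2)⁻¹) (𝓝[>] 0) atTop := by
  have h := (tendsto_pow_atTop (α := ℝ) two_ne_zero).comp tendsto_inv_nhdsGT_zero
  simpa only [Function.comp_def, inv_pow] using h

/-! ### Consistency along the trajectory. -/

namespace IsSplittingFrame

variable {H K : Type*} [NormedAddCommGroup H] [InnerProductSpace ℂ H]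
  [NormedAddCommGroup K] [InnerProductSpace ℂ K] {ι : H →L[ℂ] K} {U : ℝ → H →L[ℂ] H}
  {Q : ℝ → H →L[ℂ] H} {C : ℝ}

theorem norm_sub_le (hF : IsSplittingFrame ι U Q C) {R : ℝ} (τ : ℝ) (x : H) :
    ‖U τ (Q R x) - x‖ ≤ ‖Q R x - x‖ + ‖U τ x - x‖ := by
  have h : U τ (Q R x) - x = U τ (Q R x - x) + (U τ x - x) := by rw [map_sub]; abel
  rw [h, ← hF.norm_apply τ (Q R x - x)]
  exact norm_add_le _ _

theorem norm_map_sub_le (hF : IsSplittingFrame ι U Q C) {R : ℝ} (hR : 0 < R) (τ : ℝ) (x : H) :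
    ‖ι (U τ (Q R x) - x)‖ ≤ (C / R + C * |τ|) * ‖x‖ := by
  have h : U τ (Q R x) - x = U τ (Q R x - x) + (U τ x - x) := by rw [map_sub]; abel
  rw [h, map_add, add_mul]
  refine (norm_add_le _ _).trans (add_le_add ?_ (hF.norm_map_apply_sub_le τ x))
  rw [hF.norm_map_apply]
  exact hF.norm_map_trunc_sub_le R hR x

/-- The truncated group converges to the identity uniformly on compact sets. -/
theorem eventually_norm_sub_le (hF : IsSplittingFrame ι U Q C) (S : ℝ) {s : Set H}
    (hs : IsCompact s) {ε : ℝ} (hε : 0 < ε) : ∀ᶠ h in 𝓝[>] (0 : ℝ), ∀ R, (h ^ 2)⁻¹ < R →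
      ∀ τ, |τ| ≤ S * h → ∀ x ∈ s, ‖U τ (Q R x) - x‖ ≤ ε := by
  refine hs.induction_on (p := fun s => ∀ᶠ h in 𝓝[>] (0 : ℝ), ∀ R, (h ^ 2)⁻¹ < R →
      ∀ τ, |τ| ≤ S * h → ∀ x ∈ s, ‖U τ (Q R x) - x‖ ≤ ε) ?_ ?_ ?_ ?_
  · exact Eventually.of_forall fun _ _ _ _ _ x hx => absurd hx (Set.notMem_empty x)
  · intro s t hst ht
    filter_upwards [ht] with h hh R hR τ hτ x hx using hh R hR τ hτ x (hst hx)
  · intro s t hs ht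
    filter_upwards [hs, ht] with h hs ht R hR τ hτ x hx
    exact hx.elim (hs R hR τ hτ x) (ht R hR τ hτ x)
  · intro x _
    refine ⟨Metric.ball x (ε / 4), mem_nhdsWithin_of_mem_nhds (Metric.ball_mem_nhds x (by
      positivity)), ?_⟩
    have hU : Tendsto (fun τ => U τ x) (𝓝 0) (𝓝 x) := by
      have : Continuous fun τ => U τ x :=
        hF.continuous_apply.comp (continuous_id.prodMk continuous_const)
      simpa [hF.zero_apply] using this.tendsto 0
    obtain ⟨ρ, hρ, hρU⟩ := Metric.eventually_nhds_iff.1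
      (hU.eventually (Metric.ball_mem_nhds x (show 0 < ε / 4 by positivity)))
    obtain ⟨R₀, hR₀⟩ := eventually_atTop.1
      ((hF.tendsto_trunc x).eventually (Metric.ball_mem_nhds x (show 0 < ε / 4 by positivity)))
    have hSh : Tendsto (fun h => S * h) (𝓝[>] 0) (𝓝 0) := by
      have : Continuous fun h : ℝ => S * h := by fun_prop
      simpa using (this.tendsto 0).mono_left nhdsWithin_le_nhds
    filter_upwards [hSh.eventually (gt_mem_nhds hρ),
      tendsto_sq_inv_nhdsGT_zero.eventually (eventually_ge_atTop R₀), self_mem_nhdsWithin]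
      with h h1 h2 h3 R hR τ hτ y hy
    have hR0 : 0 < R := lt_of_le_of_lt (by positivity) hR
    have e1 := hρU (y := τ) (by rw [Real.dist_eq, sub_zero]; linarith)
    have e2 := hR₀ R (by linarith)
    rw [dist_eq_norm] at e1 e2
    rw [mem_ball_iff_norm] at hy
    have e3 := hF.norm_sub_le (R := R) τ x
    -- Contractivity of `U(τ) Q R` spreads the estimate at `x` to a neighbourhood.
    have e4 : U τ (Q R y) - y = U τ (Q R (y - x)) + (U τ (Q R x) - x) - (y - x) := by
      simp only [map_sub]; abel
    have e5 : ‖U τ (Q R (y - x))‖ ≤ ‖y - x‖ := by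
      rw [hF.norm_apply]; exact hF.norm_trunc_le R hR0 _
    rw [e4]
    have e6 := _root_.norm_sub_le (U τ (Q R (y - x)) + (U τ (Q R x) - x)) (y - x)
    have e7 := norm_add_le (U τ (Q R (y - x))) (U τ (Q R x) - x)
    linarith

variable {X : Type*} [NormedAddCommGroup X] [InnerProductSpace ℂ X] [CompleteSpace X]
  [CompleteSpace H] {J : H →L[ℂ] X} {V : H → H} {u : ℝ → H}
  {T h R S δ η Λ N c L : ℝ}

/-- Truncating Duhamel's formula cancels `U(h)Q u(t)` exactly and leaves an integral over an
interval of length `h`, whence the factor `h`. The condition `1 ≤ S` makes the times `t + h - r`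
admissible in the field estimate. -/
theorem norm_step_le (hF : IsSplittingFrame ι U Q C) (hR : 0 < R) (hh : 0 ≤ h) (hS : 1 ≤ S)
    (hV : Continuous V) (hu : ContinuousOn u (Set.Icc 0 T))
    (hduh : ∀ s ∈ Set.Icc 0 T, ∀ t ∈ Set.Icc 0 T,
      u t = U (t - s) (u s) + ∫ r in s..t, U (t - r) (V (u r)))
    (hfield : ∀ t ∈ Set.Icc 0 T, ∀ τ, |τ| ≤ S * h → ‖J (U τ (Q R (V (u t))) - V (u t))‖ ≤ η / 2)
    (hosc : ∀ s ∈ Set.Icc 0 T, ∀ t ∈ Set.Icc 0 T, |s - t| ≤ h → ‖J (V (u s) - V (u t))‖ ≤ η / 2)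
    {t : ℝ} (ht : t ∈ Set.Icc 0 T) (hth : t + h ∈ Set.Icc 0 T) :
    ‖J (Q R (u (t + h)) - (U h (Q R (u t)) + h • V (u t)))‖ ≤ h * η := by
  have hsub : Set.uIcc t (t + h) ⊆ Set.Icc 0 T := Set.ordConnected_Icc.uIcc_subset ht hth
  have hc1 : ContinuousOn (fun r => U (t + h - r) (V (u r))) (Set.uIcc t (t + h)) :=
    hF.continuous_apply.comp_continuousOn ((continuousOn_const.sub continuousOn_id).prodMk
      (hV.comp_continuousOn (hu.mono hsub)))
  have hc3 : ContinuousOn (fun r => Q R (U (t + h - r) (V (u r)))) (Set.uIcc t (t + h)) :=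
    (Q R).continuous.comp_continuousOn hc1
  have hc2 : ContinuousOn (fun r => Q R (U (t + h - r) (V (u r))) - V (u t))
      (Set.uIcc t (t + h)) := hc3.sub continuousOn_const
  have h1 : Q R (u (t + h)) - (U h (Q R (u t)) + h • V (u t)) =
      ∫ r in t..(t + h), (Q R (U (t + h - r) (V (u r))) - V (u t)) := by
    rw [intervalIntegral.integral_sub hc3.intervalIntegrable intervalIntegrable_const,
      intervalIntegral.integral_const, add_sub_cancel_left,
      ContinuousLinearMap.intervalIntegral_comp_comm _ hc1.intervalIntegrable,
      hduh t ht _ hth, map_add, add_sub_cancel_left, hF.apply_trunc R hR]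
    abel
  rw [h1, ← ContinuousLinearMap.intervalIntegral_comp_comm _ hc2.intervalIntegrable]
  have h2 := intervalIntegral.norm_integral_le_of_norm_le_const (a := t) (b := t + h) (C := η)
    (f := fun r => J (Q R (U (t + h - r) (V (u r))) - V (u t))) (fun r hr => by
      rw [Set.uIoc_of_le (by linarith)] at hr
      have hr' : r ∈ Set.Icc 0 T := ⟨ht.1.trans hr.1.le, hr.2.trans hth.2⟩
      have e1 := hfield r hr' (t + h - r) (by
        rw [abs_of_nonneg (by linarith [hr.2])]
        nlinarith [hr.1])
      have e2 := hosc r hr' t ht (by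
        rw [abs_of_nonneg (by linarith [hr.1])]; linarith [hr.2])
      rw [← hF.apply_trunc R hR, ← sub_add_sub_cancel _ (V (u r)), map_add]
      exact (norm_add_le _ _).trans (by linarith))
  rw [add_sub_cancel_left, abs_of_nonneg hh] at h2
  linarith

theorem splittingBounds (hF : IsSplittingFrame ι U Q C) (hR : 0 < R) (hh : 0 ≤ h) (hS : 1 ≤ S)
    (hη : 0 ≤ η) (hV : Continuous V) (hu : ContinuousOn u (Set.Icc 0 T))
    (hduh : ∀ s ∈ Set.Icc 0 T, ∀ t ∈ Set.Icc 0 T,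
      u t = U (t - s) (u s) + ∫ r in s..t, U (t - r) (V (u r)))
    (hJ : ∀ y, ‖J y‖ ≤ c * ‖y‖) (hJU : ∀ t y, ‖J (U t y)‖ = ‖J y‖)
    (hJQ : ∀ y, ‖J (Q R y)‖ ≤ ‖J y‖)
    (hunif : ∀ τ, |τ| ≤ S * h → ∀ x ∈ u '' Set.Icc 0 T ∪ (fun t => V (u t)) '' Set.Icc 0 T,
      ‖J (U τ (Q R x) - x)‖ ≤ η / 2)
    (hosc : ∀ s ∈ Set.Icc 0 T, ∀ t ∈ Set.Icc 0 T, |s - t| ≤ h → ‖J (V (u s) - V (u t))‖ ≤ η / 2)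
    (hlip : ∀ t ∈ Set.Icc 0 T, ∀ w, ‖w - u t‖ ≤ δ → ‖J (V w - V (u t))‖ ≤ Λ * ‖J (w - u t)‖)
    (hN : ∀ t ∈ Set.Icc 0 T, ‖J (V (u t))‖ ≤ N) :
    SplittingBounds J U (Q R) V u T h S δ η Λ N c where
  nonneg := hη
  norm_le := hJ
  norm_apply := hJU
  norm_trunc := hJQ
  trunc_sub t ht := by
    have := hunif 0 (by rw [abs_zero]; positivity) _ (Or.inl ⟨t, ht, rfl⟩)
    rw [hF.zero_apply] at this
    linarith
  traj t ht τ hτ := (hunif τ hτ _ (Or.inl ⟨t, ht, rfl⟩)).trans (by linarith)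
  field t ht τ hτ := (hunif τ hτ _ (Or.inr ⟨t, ht, rfl⟩)).trans (by linarith)
  lip := hlip
  bound := hN
  step t ht hth := hF.norm_step_le hR hh hS hV hu hduh
    (fun t ht τ hτ => hunif τ hτ _ (Or.inr ⟨t, ht, rfl⟩)) hosc ht hth

/-- Consistency in the norm of the space itself, without a rate. -/
theorem eventually_splittingBounds_strong (hF : IsSplittingFrame ι U Q C) (hS : 1 ≤ S)
    (hη : 0 < η) (hV : Continuous V) (hu : ContinuousOn u (Set.Icc 0 T))
    (hduh : ∀ s ∈ Set.Icc 0 T, ∀ t ∈ Set.Icc 0 T,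
      u t = U (t - s) (u s) + ∫ r in s..t, U (t - r) (V (u r))) (hc : 1 ≤ c)
    (hlip : ∀ t ∈ Set.Icc 0 T, ∀ w, ‖w - u t‖ ≤ δ → ‖V w - V (u t)‖ ≤ Λ * ‖w - u t‖)
    (hN : ∀ t ∈ Set.Icc 0 T, ‖V (u t)‖ ≤ N) :
    ∀ᶠ h in 𝓝[>] (0 : ℝ), ∀ R, (h ^ 2)⁻¹ < R →
      SplittingBounds (ContinuousLinearMap.id ℂ H) U (Q R) V u T h S δ η Λ N c := by
  have hVu : ContinuousOn (fun t => V (u t)) (Set.Icc 0 T) := hV.comp_continuousOn hu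
  have hK := (isCompact_Icc.image_of_continuousOn hu).union
    (isCompact_Icc.image_of_continuousOn hVu)
  obtain ⟨ρ, hρ, hρu⟩ := Metric.uniformContinuousOn_iff_le.1
    (isCompact_Icc.uniformContinuousOn_of_continuous hVu) (η / 2) (by positivity)
  filter_upwards [hF.eventually_norm_sub_le S hK (half_pos hη), self_mem_nhdsWithin,
    mem_nhdsWithin_of_mem_nhds (gt_mem_nhds hρ)] with h h1 h2 h3 R hR
  have hR0 : 0 < R := lt_of_le_of_lt (by positivity) hR
  refine hF.splittingBounds hR0 (le_of_lt h2) hS hη.le hV hu hduh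
    (fun y => le_mul_of_one_le_left (norm_nonneg y) hc) hF.norm_apply (hF.norm_trunc_le R hR0)
    (h1 R hR) (fun s hs t ht hst => ?_) hlip hN
  have := hρu s hs t ht (by rw [Real.dist_eq]; exact hst.trans (le_of_lt h3))
  rwa [dist_eq_norm] at this

/-- Consistency of first order in the weaker norm. -/
theorem eventually_splittingBounds_weak [CompleteSpace K] (hF : IsSplittingFrame ι U Q C)
    (hS : 1 ≤ S) (hV : Continuous V) (hu : ContinuousOn u (Set.Icc 0 T))
    (hduh : ∀ s ∈ Set.Icc 0 T, ∀ t ∈ Set.Icc 0 T,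
      u t = U (t - s) (u s) + ∫ r in s..t, U (t - r) (V (u r))) (hδ : 0 < δ) (hΛ : 0 ≤ Λ)
    (hc : ‖ι‖ ≤ c)
    (hlip : ∀ t ∈ Set.Icc 0 T, ∀ w, ‖w - u t‖ ≤ δ → ‖ι (V w - V (u t))‖ ≤ Λ * ‖ι (w - u t)‖)
    (hN : ∀ t ∈ Set.Icc 0 T, ‖ι (V (u t))‖ ≤ N) :
    ∃ C₀, 0 ≤ C₀ ∧ ∀ᶠ h in 𝓝[>] (0 : ℝ), ∀ R, (h ^ 2)⁻¹ < R →
      SplittingBounds ι U (Q R) V u T h S δ (C₀ * h) Λ N c := by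
  have hVu : ContinuousOn (fun t => V (u t)) (Set.Icc 0 T) := hV.comp_continuousOn hu
  have hK := (isCompact_Icc.image_of_continuousOn hu).union
    (isCompact_Icc.image_of_continuousOn hVu)
  obtain ⟨b, hb0, hb⟩ := hK.isBounded.exists_pos_norm_le
  have hC := hF.nonneg
  obtain ⟨ρ, hρ, hρu⟩ := Metric.uniformContinuousOn_iff_le.1
    (isCompact_Icc.uniformContinuousOn_of_continuous hu) δ hδ
  -- The trajectory, merely continuous in `H`, is Lipschitz in the weaker norm.
  have hincr : ∀ h, 0 ≤ h → ∀ s ∈ Set.Icc 0 T, ∀ t ∈ Set.Icc 0 T, s ≤ t → t - s ≤ h →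
      ‖ι (u t - u s)‖ ≤ (C * b + ‖ι‖ * b) * h := by
    intro h hh s hs t ht hst hle
    have e1 : u t - u s = (U (t - s) (u s) - u s) + ∫ r in s..t, U (t - r) (V (u r)) := by
      conv_lhs => rw [hduh s hs t ht]
      abel
    have e2 := intervalIntegral.norm_integral_le_of_norm_le_const (a := s) (b := t) (C := b)
      (f := fun r => U (t - r) (V (u r))) (fun r hr => by
        rw [Set.uIoc_of_le hst] at hr
        rw [hF.norm_apply]
        exact hb _ (Or.inr ⟨r, ⟨hs.1.trans hr.1.le, hr.2.trans ht.2⟩, rfl⟩))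
    have e3 := hF.norm_map_apply_sub_le (t - s) (u s)
    rw [abs_of_nonneg (sub_nonneg.2 hst)] at e2 e3
    rw [e1, map_add]
    calc _ ≤ C * (t - s) * ‖u s‖ + ‖ι‖ * (b * (t - s)) :=
          (norm_add_le _ _).trans (add_le_add e3 ((ι.le_opNorm _).trans (by gcongr)))
      _ ≤ C * h * b + ‖ι‖ * (b * h) := by
          gcongr
          exact hb _ (Or.inl ⟨s, hs, rfl⟩)
      _ = _ := by ring
  -- One summand bounds the defect of the truncated group, the other the oscillation of the field;
  -- the factor `2` is there because each must be at most `η / 2`.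
  refine ⟨2 * (C * (1 + S) * b + Λ * (C * b + ‖ι‖ * b)), by positivity, ?_⟩
  filter_upwards [self_mem_nhdsWithin, mem_nhdsWithin_of_mem_nhds (gt_mem_nhds hρ),
    mem_nhdsWithin_of_mem_nhds (gt_mem_nhds one_pos)] with h h2 h3 h4 R hR
  have hh : 0 < h := h2
  have hR0 : 0 < R := lt_of_le_of_lt (by positivity) hR
  have hosc : ∀ s ∈ Set.Icc 0 T, ∀ t ∈ Set.Icc 0 T, |s - t| ≤ h →
      ‖ι (V (u s) - V (u t))‖ ≤ Λ * ((C * b + ‖ι‖ * b) * h) := by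
    intro s hs t ht hst
    have e1 := hρu s hs t ht (by rw [Real.dist_eq]; exact hst.trans (le_of_lt h3))
    rw [dist_eq_norm] at e1
    refine (hlip t ht _ e1).trans (mul_le_mul_of_nonneg_left ?_ hΛ)
    rcases le_total s t with hle | hle
    · rw [map_sub, norm_sub_rev, ← map_sub]
      exact hincr h hh.le s hs t ht hle (by rw [abs_of_nonpos (by linarith)] at hst; linarith)
    · exact hincr h hh.le t ht s hs hle (by rwa [abs_of_nonneg (by linarith)] at hst)
  refine hF.splittingBounds hR0 hh.le hS (by positivity) hV hu hduh
    (fun y => (ι.le_opNorm y).trans (by gcongr)) hF.norm_map_apply (hF.norm_map_trunc_le R hR0)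
    (fun τ hτ x hx => ?_) (fun s hs t ht hst => (hosc s hs t ht hst).trans ?_) hlip hN
  · refine (hF.norm_map_sub_le hR0 τ x).trans ?_
    -- From `R > h⁻²` and `h < 1`: `1/R ≤ h² ≤ h`.
    have e1 : C / R ≤ C * h := by
      rw [div_eq_mul_inv]
      gcongr
      have := inv_anti₀ (by positivity) hR.le
      rw [inv_inv] at this
      nlinarith
    calc (C / R + C * |τ|) * ‖x‖ ≤ (C * h + C * (S * h)) * b := by
          gcongr
          exact hb x hx
      _ = C * (1 + S) * b * h := by ring
      _ ≤ _ := by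
        have : 0 ≤ Λ * (C * b + ‖ι‖ * b) * h := by positivity
        linarith
  · have : 0 ≤ C * (1 + S) * b * h := by positivity
    linarith

/-! ### Convergence of the scheme and the theorem. -/

omit [CompleteSpace H] in
/-- First-order convergence in the weaker norm of a spectrally truncated splitting scheme. -/
theorem exists_norm_map_sub_le (hF : IsSplittingFrame ι U Q C)
    {ΨA : ℝ → ℝ → H → Part H} {ΦB : ℝ → H → Part H} {M C₀ δ₁ : ℝ}
    (hΨA : ∀ R, 0 < R → ∀ s y, U s (Q R y) ∈ ΨA R s y)
    (hΦB : ∀ t ∈ Set.Icc 0 T, ∀ w, ‖w - u t‖ ≤ δ → ∀ b, |b| * M < δ₁ →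
      ∃ y ∈ ΦB b w, ‖y - w - b • V w‖ ≤ L * M * b ^ 2)
    (hstrong : ∀ η > 0, ∀ᶠ h in 𝓝[>] (0 : ℝ), ∀ R, (h ^ 2)⁻¹ < R →
      SplittingBounds (ContinuousLinearMap.id ℂ H) U (Q R) V u T h S δ η Λ N c)
    (hweak : ∀ᶠ h in 𝓝[>] (0 : ℝ), ∀ R, (h ^ 2)⁻¹ < R →
      SplittingBounds ι U (Q R) V u T h S δ (C₀ * h) Λ N c)
    (hT : 0 < T) (hS : 0 ≤ S) (hδ : 0 < δ) (hΛ : 0 ≤ Λ) (hN : 0 ≤ N) (hc : 0 ≤ c) (hM : 0 ≤ M)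
    (hL : 0 ≤ L) (hC₀ : 0 ≤ C₀) (hδ₁ : 0 < δ₁) {m : ℕ} {a b : Fin m → ℝ} (ha : ∑ j, a j = 1)
    (hb : ∑ j, b j = 1) (haS : ∑ j, |a j| ≤ S) (hbS : ∑ j, |b j| ≤ S) :
    ∃ C > (0 : ℝ), ∃ n₀ : ℕ, 0 < n₀ ∧ ∀ n : ℕ, n₀ ≤ n → ∀ R : ℝ, ((T / n) ^ 2)⁻¹ < R →
      ∀ k : ℕ, k ≤ n → (k : ℝ) * (T / n) ∈ Set.Icc 0 T ∧
        ∃ v ∈ partialIterate (splittingStep (ΨA R) ΦB a b (T / n)) k (u 0),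
          ‖ι (u (k * (T / n))) - ι v‖ ≤ C * (T / n) := by
  set G : ℝ := 1 + (S + S * Λ * (S + 1) + S * S * Λ * N + c * (L * M) * S ^ 2)
  have hGS : 0 ≤ S + S * Λ * (S + 1) + S * S * Λ * N + c * (L * M) * S ^ 2 := by positivity
  have hG : 1 ≤ G := by simp only [G]; linarith
  set W : ℝ := Real.exp (G * (T * (m + 1))) * (1 + G * (T * (m + 1)))
  have hW : 0 ≤ W := by positivity
  -- Chosen independently of `n`: the part `Wη + η` of the strong error uses `δ / 4`, and the rest
  -- is `O(h)`, below `δ / 4` for large `n`.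
  set η : ℝ := δ / (4 * (W + 1))
  have hη : 0 < η := by positivity
  have hηW : W * η + η = δ / 4 := by simp only [η]; field_simp
  have hstrong := hstrong η hη
  have hlin : ∀ r ε : ℝ, 0 < ε → ∀ᶠ h in 𝓝[>] (0 : ℝ), r * h < ε := fun r ε hε => by
    have : Continuous fun h : ℝ => r * h := by fun_prop
    exact (((this.tendsto' 0 0 (by simp)).mono_left nhdsWithin_le_nhds)).eventually
      (gt_mem_nhds hε)
  have hTn : Tendsto (fun n : ℕ => T / n) atTop (𝓝[>] 0) :=
    tendsto_nhdsWithin_iff.2 ⟨tendsto_const_div_atTop_nhds_zero_nat T, by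
      filter_upwards [eventually_gt_atTop 0] with n hn
      exact div_pos hT (Nat.cast_pos.2 hn)⟩
  obtain ⟨n₀, hn₀⟩ := eventually_atTop.1 (hTn.eventually (hweak.and (hstrong.and
    ((hlin (W + S * η + S * N) (δ / 4) (by positivity)).and ((hlin 1 1 one_pos).and
      (hlin (S * M) (δ₁) (by positivity)))))))
  -- `W * (C₀ + 1)` bounds the distance to `Q u`, `C₀` the distance from `Q u` to `u`, and the last
  -- `1` ensures positivity. Passing to `n₀ + 1` excludes `n = 0`.
  refine ⟨W * (C₀ + 1) + C₀ + 1, by positivity, n₀ + 1, n₀.succ_pos, fun n hn R hR k hk => ?_⟩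
  obtain ⟨hw, hs, hsm, hh1, hflow⟩ := hn₀ n (by omega)
  have hnpos : (0 : ℝ) < n := by exact_mod_cast (by omega : 0 < n)
  set h := T / n with hhdef
  have hh : 0 < h := div_pos hT hnpos
  have hR0 : 0 < R := lt_of_le_of_lt (by positivity) hR
  have hnh : n * h = T := by simp only [hhdef]; field_simp
  have hctl : SplittingControl ι U (Q R) V u (ΨA R) ΦB T h S δ η (C₀ * h) Λ N c (L * M) G :=
    { strong := hs R hR
      weak := hw R hR
      zero_apply := hF.zero_apply
      apply_apply := hF.apply_apply
      trunc_trunc := hF.trunc_trunc R hR0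
      apply_trunc := hF.apply_trunc R hR0
      mem_linear := hΨA R hR0
      exists_mem_flow := fun t ht w hwδ b hb => hΦB t ht w hwδ b (lt_of_le_of_lt (by
        calc |b| * M ≤ S * h * M := by gcongr
          _ = S * M * h := by ring) hflow)
      h_nonneg := hh.le
      h_le_one := by linarith
      S_nonneg := hS
      Λ_nonneg := hΛ
      N_nonneg := hN
      M_nonneg := by positivity
      c_nonneg := hc
      le_gain := by simp only [G]; linarith
      one_le_gain := hG }
  have hp : ∀ p ≤ n * (m + 1), h * (p : ℝ) ≤ T * (m + 1) := fun p hp => by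
    have : (p : ℝ) ≤ n * (m + 1) := by exact_mod_cast hp
    calc h * (p : ℝ) ≤ h * (n * (m + 1)) := by gcongr
      _ = T * (m + 1) := by rw [← hnh]; ring
  have hsmall : ∀ p < n * (m + 1),
      splittingError G h η p + S * h * η + S * h * N + η ≤ δ := fun p hpn => by
    have h1 := splittingError_le (G := G) (by linarith) hh.le hη.le (hp p hpn.le)
    change _ ≤ W * (η + h) at h1
    nlinarith
  obtain ⟨v, hv, -, hv0⟩ := hctl.exists_mem_partialIterate ha hb haS hbS hnh.le hsmall k hk
  have hkT : (k : ℝ) * h ∈ Set.Icc 0 T := ⟨by positivity, by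
    rw [← hnh]; gcongr⟩
  refine ⟨hkT, v, hv, ?_⟩
  have h1 := splittingError_le (G := G) (by linarith) hh.le (show 0 ≤ C₀ * h by positivity)
    (hp (k * (m + 1)) (Nat.mul_le_mul_right _ hk))
  change _ ≤ W * (C₀ * h + h) at h1
  have h2 := (hw R hR).trunc_sub _ hkT
  have h3 : ι (u (k * h)) - ι v = -(ι (v - Q R (u (k * h))) + ι (Q R (u (k * h)) - u (k * h))) := by
    simp only [map_sub]; abel
  rw [h3, norm_neg]
  have h4 := norm_add_le (ι (v - Q R (u (k * h)))) (ι (Q R (u (k * h)) - u (k * h)))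
  linarith

end IsSplittingFrame

theorem mem_truncatedFlow {H K : Type*} [NormedAddCommGroup H] [InnerProductSpace ℂ H]
    [NormedAddCommGroup K] [InnerProductSpace ℂ K] {ι : H →L[ℂ] K} (hι : Function.Injective ι)
    {P : K →L[ℂ] K} (U : ℝ → H →L[ℂ] H) (t : ℝ) {x y : H} (h : ι y = P (ι x)) :
    U t y ∈ truncatedFlow ι P U t x := by
  have hex : ∃ y : H, ι y = P (ι x) := ⟨y, h⟩
  have hy : y ∈ restrictToSubspace ι P x := ⟨hex, hι (hex.choose_spec.trans h.symm)⟩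
  exact Part.mem_map _ hy

theorem mainTheorem4
    -- the Hilbert spaces `H₁ ⊆ H₀`, with continuous embedding `ι`
    {H₁ H₀ : Type*}
    [NormedAddCommGroup H₁] [InnerProductSpace ℂ H₁] [CompleteSpace H₁]
    [NormedAddCommGroup H₀] [InnerProductSpace ℂ H₀] [CompleteSpace H₀]
    (ι : H₁ →L[ℂ] H₀) (hι : Function.Injective ι)
    -- the self-adjoint operator `A` in `H₁`, its self-adjoint extension `A₀` in `H₀`
    (A : H₁ →ₗ.[ℂ] H₁) (hA : IsSelfAdjoint A)
    (A₀ : H₀ →ₗ.[ℂ] H₀) (hA₀ : IsSelfAdjoint A₀)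
    (hdom : ∀ x : H₁, ι x ∈ A₀.domain)
    (hext : ∀ x : A.domain, A₀ ⟨ι (x : H₁), hdom x⟩ = ι (A x))
    -- the unitary group generated by `-iA` and the spectral measure of `A₀`
    (ΦA : ℝ → H₁ →L[ℂ] H₁) (hΦA : IsUnitaryGroupGeneratedBy A ΦA)
    (E : ProjectionValuedMeasure H₀) (hE : IsSpectralMeasureOf A₀ E)
    -- the nonlinearity
    (B : H₁ → H₁) (hB : LocallyLipschitz B)
    (B' : H₁ → H₀ →L[ℝ] H₀)
    (hB' : ∀ r > (0 : ℝ), ∀ ε > (0 : ℝ), ∃ C > (0 : ℝ), ∃ δ > (0 : ℝ),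
      ∀ u w : H₁, ‖u‖ ≤ r → ‖w‖ < δ →
        ‖B' u‖ ≤ C ∧ ‖ι (B (u + w)) - ι (B u) - B' u (ι w)‖ ≤ ε * ‖ι w‖)
    -- the splitting coefficients
    {m : ℕ} (a b : Fin m → ℝ) (ha : ∑ j, a j = 1) (hb : ∑ j, b j = 1)
    -- the initial datum and the final time
    (u₀ : H₁) (T : ℝ) (hT : 0 < T) (hT' : (T : EReal) < maximalTime ΦA B u₀) :
    ∃ C > (0 : ℝ), ∃ n₀ : ℕ, 0 < n₀ ∧ ∀ n : ℕ, n₀ ≤ n → ∀ R : ℝ, ((T / n) ^ 2)⁻¹ < R →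
      ∀ k : ℕ, k ≤ n →
        ∃ u ∈ exactFlow ΦA B (k * (T / n)) u₀,
        ∃ v ∈ partialIterate
            (splittingStep (truncatedFlow ι (E.proj (Set.Icc (-R) R)) ΦA) (nonlinearFlow B)
              a b (T / n)) k u₀,
          ‖ι u - ι v‖ ≤ C * (T / n) := by
  have hg : ∀ x y, (x, y) ∈ A.graph → (ι x, ι y) ∈ A₀.graph := fun x y h => by
    obtain ⟨z, rfl, rfl⟩ := A.mem_graph_iff.1 h
    rw [← hext z]
    exact A₀.mem_graph ⟨ι z, hdom z⟩
  obtain ⟨Q, C, hF, hQ⟩ := exists_isSplittingFrame hι hA hA₀ hdom hg hΦA hE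
  obtain ⟨u, hu⟩ := exists_isDuhamelSolution_of_lt_maximalTime hT'
  have hu0 : u 0 = u₀ := by
    have := hu.2 0 ⟨le_rfl, hT.le⟩
    simpa [hΦA.zero_apply] using this
  set V : H₁ → H₁ := fun x => -(Complex.I • B x) with hVdef
  have hVnorm : ∀ x y, V x - V y = -(Complex.I • (B x - B y)) := fun x y => by
    simp only [hVdef, smul_sub]; abel
  have hVL : LocallyLipschitz V := by
    have h : LipschitzWith 1 fun x : H₁ => -(Complex.I • x) :=
      LipschitzWith.of_dist_le_mul fun x y => by
        rw [dist_eq_norm, neg_sub_neg, ← smul_sub, norm_smul, Complex.norm_I, norm_sub_rev,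
          dist_eq_norm, NNReal.coe_one]
    exact h.locallyLipschitz.comp hB
  have hduh : ∀ s ∈ Set.Icc 0 T, ∀ t ∈ Set.Icc 0 T,
      u t = ΦA (t - s) (u s) + ∫ r in s..t, ΦA (t - r) (V (u r)) := fun s hs t ht =>
    hu.eq_add_integral hΦA hB.continuous hs ht
  have hK := isCompact_Icc.image_of_continuousOn hu.1
  obtain ⟨δ₁, hδ₁, L, M, hLM⟩ := hVL.exists_lipschitzOnWith_closedBall hK
  have hLM : ∀ t ∈ Set.Icc 0 T, LipschitzOnWith L V (Metric.closedBall (u t) δ₁) ∧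
      ∀ y ∈ Metric.closedBall (u t) δ₁, ‖V y‖ ≤ M := fun t ht => hLM _ ⟨t, ht, rfl⟩
  obtain ⟨r, hr0, hr⟩ := hK.isBounded.exists_pos_norm_le
  -- Only a Lipschitz bound in the weaker norm is needed, so `ε = 1` suffices.
  obtain ⟨L₀, hL₀, δ₂, hδ₂, hB'⟩ := hB' r hr0 1 one_pos
  -- With `δ ≤ δ₁ / 2`, a ball of radius `δ₁ / 2` around a point of the tube stays where `V` is
  -- controlled; `δ ≤ δ₂ / 2` yields the strict inequality needed for `B'`.
  set δ := min (δ₁ / 2) (δ₂ / 2) with hδdef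
  have hδ : 0 < δ := by positivity
  have hδ1 : δ ≤ δ₁ / 2 := min_le_left _ _
  have hδ2 : δ ≤ δ₂ / 2 := min_le_right _ _
  -- The constants `Λ`, `c`, `N` are taken large enough to serve both norms at once.
  set Λ : ℝ := max L (L₀ + 1)
  set c : ℝ := ‖ι‖ + 1
  set N : ℝ := c * M
  set S : ℝ := 1 + ∑ j, |a j| + ∑ j, |b j|
  have ha0 : 0 ≤ ∑ j, |a j| := Finset.sum_nonneg fun _ _ => abs_nonneg _
  have hb0 : 0 ≤ ∑ j, |b j| := Finset.sum_nonneg fun _ _ => abs_nonneg _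
  have hS : 1 ≤ S := by simp only [S]; linarith
  have hc : 1 ≤ c := by simp only [c]; linarith [norm_nonneg ι]
  have hΛ : 0 ≤ Λ := le_max_of_le_left L.2
  have hN : 0 ≤ N := by positivity
  have hMu : ∀ t ∈ Set.Icc 0 T, ‖V (u t)‖ ≤ M := fun t ht =>
    (hLM t ht).2 _ (Metric.mem_closedBall_self hδ₁.le)
  have hlip1 : ∀ t ∈ Set.Icc 0 T, ∀ w, ‖w - u t‖ ≤ δ → ‖V w - V (u t)‖ ≤ Λ * ‖w - u t‖ := by
    intro t ht w hw
    have h := (hLM t ht).1.dist_le_mul w (by rw [mem_closedBall_iff_norm]; linarith)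
      (u t) (Metric.mem_closedBall_self hδ₁.le)
    rw [dist_eq_norm, dist_eq_norm] at h
    exact h.trans (by gcongr; exact le_max_left _ _)
  have hlip0 : ∀ t ∈ Set.Icc 0 T, ∀ w, ‖w - u t‖ ≤ δ →
      ‖ι (V w - V (u t))‖ ≤ Λ * ‖ι (w - u t)‖ := by
    intro t ht w hw
    obtain ⟨h1, h2⟩ := hB' (u t) (w - u t) (hr _ ⟨t, ht, rfl⟩) (by linarith)
    rw [add_sub_cancel, one_mul] at h2
    rw [hVnorm, map_neg, norm_neg, map_smul, norm_smul, Complex.norm_I, one_mul, map_sub]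
    have h3 := (B' (u t)).le_of_opNorm_le h1 (ι (w - u t))
    calc ‖ι (B w) - ι (B (u t))‖
        = ‖(ι (B w) - ι (B (u t)) - B' (u t) (ι (w - u t))) + B' (u t) (ι (w - u t))‖ := by
          rw [sub_add_cancel]
      _ ≤ ‖ι (w - u t)‖ + L₀ * ‖ι (w - u t)‖ := (norm_add_le _ _).trans (add_le_add h2 h3)
      _ = (L₀ + 1) * ‖ι (w - u t)‖ := by ring
      _ ≤ Λ * ‖ι (w - u t)‖ := by gcongr; exact le_max_right _ _
  obtain ⟨C₀, hC₀, hweak⟩ := hF.eventually_splittingBounds_weak (c := c) (N := N) hS hVL.continuous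
    hu.1 hduh hδ hΛ (by simp only [c]; linarith) hlip0 (fun t ht =>
      (ι.le_opNorm _).trans (mul_le_mul (by simp only [c]; linarith) (hMu t ht) (norm_nonneg _)
        (by positivity)))
  have hstrong : ∀ η > 0, ∀ᶠ h in 𝓝[>] (0 : ℝ), ∀ R, (h ^ 2)⁻¹ < R →
      SplittingBounds (ContinuousLinearMap.id ℂ H₁) ΦA (Q R) V u T h S δ η Λ N c := fun η hη =>
    hF.eventually_splittingBounds_strong hS hη hVL.continuous hu.1 hduh hc hlip1
      (fun t ht => (hMu t ht).trans (le_mul_of_one_le_left M.2 hc))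
  obtain ⟨C', hC', n₀, hn₀, hmain⟩ := hF.exists_norm_map_sub_le (L := L)
    (ΨA := fun R => truncatedFlow ι (E.proj (Set.Icc (-R) R)) ΦA) (ΦB := nonlinearFlow B)
    (fun R hR s y => mem_truncatedFlow hι ΦA s (hQ R hR y))
    (fun t ht w hwδ b hb => by
      have hsub : Metric.closedBall w (δ₁ / 2) ⊆ Metric.closedBall (u t) δ₁ :=
        Metric.closedBall_subset_closedBall' (by rw [dist_eq_norm]; linarith)
      exact exists_mem_nonlinearFlow ((hLM t ht).1.mono hsub)
        (fun y hy => (hLM t ht).2 y (hsub hy)) hb)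
    hstrong hweak hT (zero_le_one.trans hS) hδ hΛ hN (zero_le_one.trans hc) M.2 L.2 hC₀
    (half_pos hδ₁) ha hb (by simp only [S]; linarith) (by simp only [S]; linarith)
  refine ⟨C', hC', n₀, hn₀, fun n hn R hR k hk => ?_⟩
  obtain ⟨hkT, v, hv, hle⟩ := hmain n hn R hR k hk
  rw [hu0] at hv
  exact ⟨_, hu.mem_exactFlow hΦA hB hkT, v, hv, hle⟩
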